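/- Let $B_r=\{x\in\mathbb R^n:|x|<r\}$, let $\sigma_k(W)$ denote the $k$-th elementary symmetric function of the eigenvalues of a symmetric $n\times n$ matrix $W$ (so $\sigma_k(W)=0$ if $k>n$), and let $A\ge 0$. Let $u\in C^4(\overline B_1)$ be an admissible solution of $$\sigma_2(D^2u(x))=f(x,u(x),Du(x))>0,\qquad x\in B_1,$$ where admissible means that $\sigma_1(D^2u)>0$ and $\sigma_2(D^2u)>0$ in $B_1$, and $f$ is a positive $C^2$ function on an open set $\Omega\subset\mathbb R^n\times\mathbb R\times\mathbb R^n$ that contains all the points $(x,u(x),Du(x))$, $x\in B_1$. Suppose that $$\sigma_3(D^2u(x))\ge -A\qquad\text{for all }x\in B_1.$$ Then $$\max_{x\in \overline B_{1/2}}|D^2u(x)|\le C,$$ where $C$ depends only on $n$, $A$ and upper bounds for $\|u\|_{C^1(B_1)}$, $\|f\|_{C^2(\Omega)}$ and $\|1/f\|_{L^\infty(\Omega)}$ (all assumed finite). In particular, if a solution $u\in C^4(\overline B_1)$ of the equation is convex, then the same estimate holds, with $C$ depending only on $n$ and upper bounds for $\|u\|_{C^1(B_1)}$, $\|f\|_{C^2(\Omega)}$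 and $\|1/f\|_{L^\infty(\Omega)}$; here neither admissibility nor the bound on $\sigma_3$ has to be assumed. -/

import Mathlib

open Set Metric
open scoped NNReal ENNReal

namespace SigmaTwo

/-- `Sp n` is the Euclidean space of dimension `n`. -/
abbrev Sp (n : ℕ) : Type := EuclideanSpace ℝ (Fin n)

/-- `Jet n` is the space `ℝⁿ × ℝ × ℝⁿ` of triples `(x, z, p)`. -/
abbrev Jet (n : ℕ) : Type := Sp n × ℝ × Sp n

/-- `sigma k W`: the `k`-th elementary symmetric function of the eigenvalues of the (symmetric)
matrix `W`, counted with multiplicity. A real symmetric matrix has `n` real eigenvalues, and they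
are the roots of its characteristic polynomial. -/
noncomputable def sigma {n : ℕ} (k : ℕ) (W : Matrix (Fin n) (Fin n) ℝ) : ℝ :=
  W.charpoly.roots.esymm k

/-- The cone `Γ₂`. -/
def Gamma2 {n : ℕ} (W : Matrix (Fin n) (Fin n) ℝ) : Prop :=
  0 < sigma 1 W ∧ 0 < sigma 2 W

/-- The Hessian matrix `(u_{ij}(x))`. -/
noncomputable def hessian {n : ℕ} (u : Sp n → ℝ) (x : Sp n) : Matrix (Fin n) (Fin n) ℝ :=
  Matrix.of fun i j =>
    iteratedFDeriv ℝ 2 u x ![EuclideanSpace.single i 1, EuclideanSpace.single j 1]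

/-- The (Euclidean) norm `|D²u(x)|` of the Hessian. -/
noncomputable def hessianNorm {n : ℕ} (u : Sp n → ℝ) (x : Sp n) : ℝ :=
  Real.sqrt (∑ i, ∑ j, hessian u x i j ^ 2)

/-- The point `(x, u(x), Du(x))`. -/
noncomputable def oneJet {n : ℕ} (u : Sp n → ℝ) (x : Sp n) : Jet n :=
  (x, u x, gradient u x)

/-- The `C^k` norm `∑_{j ≤ k} sup_S |D^j g|` of a function on an open set `S`
(possibly infinite). -/
noncomputable def cNorm {F : Type*} [NormedAddCommGroup F] [NormedSpace ℝ F]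
    (k : ℕ) (S : Set F) (g : F → ℝ) : ℝ≥0∞ :=
  ∑ j ∈ Finset.range (k + 1), ⨆ y ∈ S, ‖iteratedFDeriv ℝ j g y‖ₑ

/-- The sup norm over `S` (possibly infinite). -/
noncomputable def supNorm {F : Type*} (S : Set F) (g : F → ℝ) : ℝ≥0∞ :=
  ⨆ y ∈ S, ‖g y‖ₑ

/-- `u ∈ C⁴` of the closed unit ball solves `σ₂(D²u) = f(x, u, Du)` in the open unit ball `B₁`,
where `f` is a positive `C²` function on the open set `Ω`, which contains all the points
`(x, u(x), Du(x))` with `x ∈ B₁`. -/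
structure IsSolution {n : ℕ} (Ω : Set (Jet n)) (f : Jet n → ℝ) (u : Sp n → ℝ) : Prop where
  isOpen : IsOpen Ω
  contDiffOn_f : ContDiffOn ℝ 2 f Ω
  f_pos : ∀ y ∈ Ω, 0 < f y
  contDiffOn_u : ContDiffOn ℝ 4 u (closedBall 0 1)
  oneJet_mem : ∀ x ∈ ball (0 : Sp n) 1, oneJet u x ∈ Ω
  eqn : ∀ x ∈ ball (0 : Sp n) 1, sigma 2 (hessian u x) = f (oneJet u x)

/-- An admissible solution: the Hessian lies in `Γ₂` at every point of `B₁`. -/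
structure IsAdmissibleSolution {n : ℕ} (Ω : Set (Jet n)) (f : Jet n → ℝ) (u : Sp n → ℝ) : Prop
    extends IsSolution Ω f u where
  admissible : ∀ x ∈ ball (0 : Sp n) 1, Gamma2 (hessian u x)

end SigmaTwo

/-! The proof is a maximum principle argument for `testFun`, that is cutoff² · exp(weight) · log
u_ξξ, over points and unit directions ξ. Bounding the largest eigenvalue λ of D²u suffices, because
|D²u|² = σ₁² − 2f < σ₁².

The bound on σ₃ is used only in `exists_eigenvalue_gap`: when λ is large, the other eigenvalues are
small and s = σ₁ − λ is small, while sσ₁ ≥ f stays away from zero. Hence the linearized operator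
Σ(σ₁ − λ_i)∂_ii has coefficients of size λ, except in the top eigendirection o, where the
coefficient is s, of size 1/λ.

At a maximum, in the eigenframe of D²u, let w be the gradient of 2 log ρ + weight, where ρ is the
cutoff, and put L = log λ. Criticality gives u_ooi = −λLw_i. Applying the linearized operator and
the twice differentiated equation leaves the third order terms Σu_ijo² − (Σu_iio)². The once
differentiated equation forces Σ_{i≠o} u_iio to be about −s·u_ooo/σ₁, so the cross term −2u_ooo
Σ_{i≠o} u_iio is positive, about 2s·u_ooo²/σ₁. After division by λL this beats the loss (L+1)Σ(σ₁ −
λ_i)w_i² caused by the double logarithm. What remains (`max_point_reduction`) is αλ/(2K) + (L/2)λ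
Σ_{i≠o} w_i² + (L/8)s·w_o² ≤ Nλ/ρ².

The position of the maximum then decides (`max_point_cases`). Near the centre, the α-term, which
comes from |Du|², is too large. Otherwise some coordinate of x in the eigenframe is not small. If it
is not the top one, the cutoff makes w_i of size 1/ρ, and L is too large. If it is the top one, the
β-term, which comes from x·Du − u, forces |w_o| ≥ λ, and ρ²L is bounded.

For convex u the eigenvalues are nonnegative, so the same estimate applies with A = 0. -/

namespace SigmaTwo

/-! ### Elementary symmetric functions and traces of a symmetric matrix -/

theorem sigma_eq_eval_esymm {n : ℕ} {W : Matrix (Fin n) (Fin n) ℝ} (hW : W.IsHermitian) (k : ℕ) :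
    sigma k W = MvPolynomial.eval hW.eigenvalues (MvPolynomial.esymm (Fin n) ℝ k) := by
  rw [← MvPolynomial.coe_aeval_eq_eval, RingHom.coe_coe, MvPolynomial.aeval_esymm_eq_multiset_esymm, sigma, hW.roots_charpoly_eq_eigenvalues]
  rfl

theorem sigma_one_eq_sum {n : ℕ} {W : Matrix (Fin n) (Fin n) ℝ} (hW : W.IsHermitian) :
    sigma 1 W = ∑ i, hW.eigenvalues i := by
  rw [sigma_eq_eval_esymm hW, MvPolynomial.esymm_one]
  simp

theorem two_mul_sigma_two {n : ℕ} {W : Matrix (Fin n) (Fin n) ℝ} (hW : W.IsHermitian) :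
    2 * sigma 2 W = (∑ i, hW.eigenvalues i) ^ 2 - ∑ i, hW.eigenvalues i ^ 2 := by
  have h := congrArg (MvPolynomial.eval hW.eigenvalues)
    (MvPolynomial.mul_esymm_eq_sum (Fin n) ℝ 2)
  have hs : (Finset.HasAntidiagonal.antidiagonal 2).filter (fun a : ℕ × ℕ => a.1 < 2) = {(0, 2), (1, 1)} := by
    decide
  rw [hs] at h
  simp [MvPolynomial.psum] at h
  rw [sigma_eq_eval_esymm hW, h]
  ring

theorem six_mul_sigma_three {n : ℕ} {W : Matrix (Fin n) (Fin n) ℝ} (hW : W.IsHermitian) :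
    6 * sigma 3 W = (∑ i, hW.eigenvalues i) ^ 3
      - 3 * (∑ i, hW.eigenvalues i) * (∑ i, hW.eigenvalues i ^ 2)
      + 2 * ∑ i, hW.eigenvalues i ^ 3 := by
  have h := congrArg (MvPolynomial.eval hW.eigenvalues)
    (MvPolynomial.mul_esymm_eq_sum (Fin n) ℝ 3)
  have hs : (Finset.HasAntidiagonal.antidiagonal 3).filter (fun a : ℕ × ℕ => a.1 < 3)
      = {(0, 3), (1, 2), (2, 1)} := by
    decide
  have h2 := two_mul_sigma_two hW
  rw [hs] at h
  simp [MvPolynomial.psum] at h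
  rw [sigma_eq_eval_esymm hW] at h2 ⊢
  linear_combination 2 * h + (∑ i, hW.eigenvalues i) * h2

theorem sum_inner_toEuclideanLin {n : ℕ} (W : Matrix (Fin n) (Fin n) ℝ)
    (b c : OrthonormalBasis (Fin n) ℝ (Sp n)) :
    ∑ i, inner ℝ (b i) (W.toEuclideanLin (b i)) = ∑ i, inner ℝ (c i) (W.toEuclideanLin (c i)) := by
  rw [← LinearMap.trace_eq_sum_inner, ← LinearMap.trace_eq_sum_inner]

/-- Both sides are the trace of W². -/
theorem sum_sq_inner_toEuclideanLin {n : ℕ} {W : Matrix (Fin n) (Fin n) ℝ} (hW : W.IsHermitian)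
    (b c : OrthonormalBasis (Fin n) ℝ (Sp n)) :
    ∑ i, ∑ j, inner ℝ (b i) (W.toEuclideanLin (b j)) ^ 2
      = ∑ i, ∑ j, inner ℝ (c i) (W.toEuclideanLin (c j)) ^ 2 := by
  have hs : W.toEuclideanLin.IsSymmetric := Matrix.isSymmetric_toEuclideanLin_iff.2 hW
  have key : ∀ d : OrthonormalBasis (Fin n) ℝ (Sp n),
      ∑ i, ∑ j, inner ℝ (d i) (W.toEuclideanLin (d j)) ^ 2
        = LinearMap.trace ℝ (Sp n) (W.toEuclideanLin ∘ₗ W.toEuclideanLin) := by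
    intro d
    rw [LinearMap.trace_eq_sum_inner _ d, Finset.sum_comm]
    refine Finset.sum_congr rfl fun j _ => ?_
    rw [LinearMap.comp_apply, ← hs, real_inner_self_eq_norm_sq, ← d.sum_sq_norm_inner_right]
    simp
  rw [key, key]

theorem inner_eigenvectorBasis {n : ℕ} {W : Matrix (Fin n) (Fin n) ℝ} (hW : W.IsHermitian)
    (i j : Fin n) :
    inner ℝ (hW.eigenvectorBasis i) (W.toEuclideanLin (hW.eigenvectorBasis j))
      = if i = j then hW.eigenvalues i else 0 := by
  have h : W.toEuclideanLin (hW.eigenvectorBasis j)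
      = hW.eigenvalues j • hW.eigenvectorBasis j := by
    ext k
    have := congrFun (hW.mulVec_eigenvectorBasis j) k
    simpa [Matrix.toLpLin_apply] using this
  rw [h, inner_smul_right, orthonormal_iff_ite.1 hW.eigenvectorBasis.orthonormal]
  split_ifs with hij <;> simp [hij]

theorem sum_eigenvalues {n : ℕ} {W : Matrix (Fin n) (Fin n) ℝ} (hW : W.IsHermitian)
    (b : OrthonormalBasis (Fin n) ℝ (Sp n)) :
    ∑ i, hW.eigenvalues i = ∑ i, inner ℝ (b i) (W.toEuclideanLin (b i)) := by
  rw [sum_inner_toEuclideanLin W b hW.eigenvectorBasis]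
  simp [inner_eigenvectorBasis hW]

theorem sum_sq_eigenvalues {n : ℕ} {W : Matrix (Fin n) (Fin n) ℝ} (hW : W.IsHermitian)
    (b : OrthonormalBasis (Fin n) ℝ (Sp n)) :
    ∑ i, hW.eigenvalues i ^ 2 = ∑ i, ∑ j, inner ℝ (b i) (W.toEuclideanLin (b j)) ^ 2 := by
  rw [sum_sq_inner_toEuclideanLin hW b hW.eigenvectorBasis]
  simp [inner_eigenvectorBasis hW, ite_pow]

theorem inner_toEuclideanLin_le {n : ℕ} {W : Matrix (Fin n) (Fin n) ℝ} (hW : W.IsHermitian)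
    {Λ : ℝ} (hΛ : ∀ i, hW.eigenvalues i ≤ Λ) (v : Sp n) :
    inner ℝ v (W.toEuclideanLin v) ≤ Λ * ‖v‖ ^ 2 := by
  set b := hW.eigenvectorBasis
  have h : inner ℝ v (W.toEuclideanLin v) = ∑ i, hW.eigenvalues i * inner ℝ (b i) v ^ 2 := by
    rw [← b.sum_inner_mul_inner]
    refine Finset.sum_congr rfl fun i _ => ?_
    have hs : W.toEuclideanLin.IsSymmetric := Matrix.isSymmetric_toEuclideanLin_iff.2 hW
    have h2 : W.toEuclideanLin (b i) = hW.eigenvalues i • b i := by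
      ext k
      have := congrFun (hW.mulVec_eigenvectorBasis i) k
      simpa [Matrix.toLpLin_apply, b] using this
    rw [← hs, h2, inner_smul_left, real_inner_comm v]
    simp; ring
  rw [h, ← b.sum_sq_norm_inner_right, Finset.mul_sum]
  refine Finset.sum_le_sum fun i _ => ?_
  rw [Real.norm_eq_abs, sq_abs]
  exact mul_le_mul_of_nonneg_right (hΛ i) (sq_nonneg _)

/-! ### The eigenvalue gap forced by a lower bound on σ₃ -/

/-- Two passes through Newton's formula for σ₃, with s = σ₁ − λ_max. Replacing Σλ_i³ by λ_max Σλ_i²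
gives sσ₁² ≤ 3fσ₁ + 3A, so s is of order 1/σ₁, and s(σ₁ + λ_max) = q + 2f bounds the sum q of the
other squares. The other eigenvalues are then at most σ₁/2; using this for their cubes in the same
formula bounds σ₁q. -/
theorem exists_eigenvalue_gap {A M ε : ℝ} (hA : 0 ≤ A) (hM : 0 ≤ M) (hε : 0 < ε) :
    ∃ Λ : ℝ, 1 ≤ Λ ∧ ∀ (n : ℕ) (l : Fin n → ℝ) (o : Fin n) (f : ℝ),
      (∀ i, l i ≤ l o) → 0 < f → f ≤ M → 0 < ∑ i, l i →
      (∑ i, l i) ^ 2 - ∑ i, l i ^ 2 = 2 * f →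
      -(6 * A) ≤ (∑ i, l i) ^ 3 - 3 * (∑ i, l i) * (∑ i, l i ^ 2) + 2 * ∑ i, l i ^ 3 →
      Λ ≤ l o →
      (∑ i, l i) - l o ≤ ε ∧ ∑ i ∈ Finset.univ.erase o, l i ^ 2 ≤ ε ∧
        f ≤ ((∑ i, l i) - l o) * ∑ i, l i := by
  obtain ⟨B, hB⟩ : ∃ B, B = 3 * M + 3 * A := ⟨_, rfl⟩
  have hB0 : 0 ≤ B := by rw [hB]; positivity
  -- The summands serve in turn for λ_max ≥ 1, for the other eigenvalues to lie below σ₁/2, for s ≤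
  -- ε and for q ≤ ε.
  refine ⟨1 + 8 * B + B / ε + (3 * A + 3 / 2 * B ^ 2) / ε, ?_, ?_⟩
  · have : 0 ≤ 8 * B + B / ε + (3 * A + 3 / 2 * B ^ 2) / ε := by positivity
    linarith
  intro n l o f hl hf hfM hσ h2 h3 hΛ
  have e1 := Finset.add_sum_erase Finset.univ (fun i => l i ^ 2) (Finset.mem_univ o)
  have e3 := Finset.add_sum_erase Finset.univ (fun i => l i ^ 3) (Finset.mem_univ o)
  have hp3 : ∑ i, l i ^ 3 ≤ l o * ∑ i, l i ^ 2 := by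
    rw [Finset.mul_sum]
    refine Finset.sum_le_sum fun i _ => ?_
    nlinarith [hl i, sq_nonneg (l i)]
  have hq0 : 0 ≤ ∑ i ∈ Finset.univ.erase o, l i ^ 2 :=
    Finset.sum_nonneg fun i _ => sq_nonneg _
  have hle : ∀ i ∈ Finset.univ.erase o, l i ^ 2 ≤ ∑ i ∈ Finset.univ.erase o, l i ^ 2 :=
    fun i hi => Finset.single_le_sum (f := fun i => l i ^ 2) (fun i _ => sq_nonneg _) hi
  have ht : ∀ c : ℝ, (∀ i ∈ Finset.univ.erase o, l i ≤ c) →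
      ∑ i ∈ Finset.univ.erase o, l i ^ 3 ≤ c * ∑ i ∈ Finset.univ.erase o, l i ^ 2 := by
    intro c hc
    rw [Finset.mul_sum]
    refine Finset.sum_le_sum fun i hi => ?_
    nlinarith [hc i hi, sq_nonneg (l i)]
  generalize (∑ i, l i) = σ at *
  generalize (∑ i, l i ^ 2) = p2 at *
  generalize (∑ i, l i ^ 3) = p3 at *
  generalize (∑ i ∈ Finset.univ.erase o, l i ^ 2) = q at *
  generalize (∑ i ∈ Finset.univ.erase o, l i ^ 3) = t at *
  obtain ⟨x, hx⟩ : ∃ x, l o = x := ⟨_, rfl⟩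
  rw [hx] at hΛ hp3 e1 e3 ⊢
  obtain ⟨s, hs⟩ : ∃ s, s = σ - x := ⟨_, rfl⟩
  rw [← hs]
  have hb1 : 0 ≤ B / ε := by positivity
  have hb2 : 0 ≤ (3 * A + 3 / 2 * B ^ 2) / ε := by positivity
  have hx1 : 1 ≤ x := by linarith
  have hsσ : s * (σ + x) = q + 2 * f := by rw [hs]; linarith only [h2, e1]
  have hs0 : 0 < s := by
    by_contra h
    have : s * (σ + x) ≤ 0 := mul_nonpos_of_nonpos_of_nonneg (not_lt.1 h) (by linarith)
    linarith
  have hσx : x ≤ σ := by linarith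
  have hsB : s * σ ≤ B := by
    have h4 : s * σ ^ 2 ≤ 3 * f * σ + 3 * A := by
      have : p2 = σ ^ 2 - 2 * f := by linarith
      subst this
      rw [hs]
      nlinarith only [h3, hp3, mul_pos hf (lt_of_lt_of_le one_pos hx1)]
    have h5 : (s * σ) * σ ≤ B * σ := by
      have h4' : 3 * f * σ + 3 * A ≤ B * σ := by
        rw [hB]
        nlinarith only [mul_nonneg (sub_nonneg.2 hfM) hσ.le,
          mul_nonneg hA (sub_nonneg.2 (hx1.trans hσx))]
      linarith only [h4, h4']
    exact le_of_mul_le_mul_right h5 (by linarith)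
  have hq2 : q ≤ 2 * B := by nlinarith only [hsσ, hsB, mul_nonneg hs0.le (sub_nonneg.2 hσx), hf]
  have hsB' : s ≤ B := by
    nlinarith only [hsB, mul_nonneg hs0.le (sub_nonneg.2 (hx1.trans hσx))]
  have hc : ∀ i ∈ Finset.univ.erase o, l i ≤ σ / 2 := by
    intro i hi
    refine (le_abs_self _).trans (abs_le_of_sq_le_sq (b := σ / 2) ?_ (by linarith))
    have h7 := hle i hi
    have h8 : 8 * B ≤ σ := by linarith
    nlinarith only [h7, h8, hq2, hx1.trans hσx, hB0]
  have h6 := ht _ hc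
  have hq : σ * q ≤ 3 * A + 3 / 2 * B ^ 2 := by
    have h7 : 3 / 2 * σ * q ≤ t + 3 * A + 3 / 2 * σ * s ^ 2 := by
      have e5 : σ = x + s := by linarith
      have e7 : p2 = x ^ 2 + q := by linarith
      have e8 : p3 = x ^ 3 + t := by linarith
      have hs3 : 0 ≤ s ^ 3 := by positivity
      rw [e7, e8, e5] at h3
      rw [e5]
      linarith only [h3, hs3]
    have h8 : σ * s ^ 2 ≤ B ^ 2 := by
      nlinarith only [mul_le_mul hsB hsB' hs0.le hB0]
    linarith
  refine ⟨?_, ?_, ?_⟩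
  · have : B ≤ x * ε := by
      have : B / ε ≤ x := by linarith
      rwa [div_le_iff₀ hε] at this
    have h9 : s * σ ≤ ε * σ := by
      nlinarith only [this, hsB, mul_nonneg hε.le (sub_nonneg.2 hσx)]
    exact le_of_mul_le_mul_right h9 (by linarith)
  · have : 3 * A + 3 / 2 * B ^ 2 ≤ x * ε := by
      have : (3 * A + 3 / 2 * B ^ 2) / ε ≤ x := by linarith
      rwa [div_le_iff₀ hε] at this
    have h9 : q * σ ≤ ε * σ := by
      nlinarith only [this, hq, mul_nonneg hε.le (sub_nonneg.2 hσx)]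
    exact le_of_mul_le_mul_right h9 (by linarith)
  · nlinarith only [hsσ, hq0, mul_nonneg hs0.le (sub_nonneg.2 hσx)]

/-! ### The inequality at a maximum point, as algebra of real numbers -/

/-- Here a = u_ooo, while Y, S and R stand for the sums over i ≠ o of u_iio², u_iio and λ_i u_iio,
so `hS` is the differentiated equation. Substituting S, the term −2aS yields 2sσa² after
multiplication by σ²; the smallness of q and s costs at most a quarter of it, whence the 3/2. -/
theorem third_order_bound {Y S R σ s q g a m : ℝ} (hY : 0 ≤ Y) (hR : R ^ 2 ≤ q * Y)
    (hS : σ * S = g - s * a + R) (hσ : 0 < σ) (hs : 0 ≤ s) (hq : 0 ≤ q) (hqσ : 12 * q ≤ σ ^ 2)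
    (hqm : 8 * q ≤ m) (hm : m ≤ s * σ) (hsσ : 12 * s ≤ σ) :
    3 / 2 * (s * σ * a ^ 2) - 2 * a * g * σ - 3 * g ^ 2 ≤ σ ^ 2 * (Y - 2 * a * S - S ^ 2) := by
  -- Arithmetic-geometric mean inequality, after R² ≤ qY.
  have h1 : |2 * a * σ * R| ≤ σ ^ 2 * Y / 2 + 2 * a ^ 2 * q := by
    refine abs_le_of_sq_le_sq ?_ (by positivity)
    have h2 : (2 * a * σ * R) ^ 2 ≤ 4 * a ^ 2 * σ ^ 2 * (q * Y) := by
      nlinarith [mul_le_mul_of_nonneg_left hR (show 0 ≤ 4 * a ^ 2 * σ ^ 2 by positivity)]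
    nlinarith [sq_nonneg (σ ^ 2 * Y / 2 - 2 * a ^ 2 * q)]
  have h3 := (abs_le.1 h1).2
  have e : σ ^ 2 * (Y - 2 * a * S - S ^ 2)
      = σ ^ 2 * Y - 2 * a * σ * (g - s * a + R) - (g - s * a + R) ^ 2 := by
    rw [← hS]; ring
  have h4 : (g - s * a + R) ^ 2 ≤ 3 * (g ^ 2 + s ^ 2 * a ^ 2 + R ^ 2) := by
    nlinarith [sq_nonneg (g + s * a), sq_nonneg (g - R), sq_nonneg (s * a + R)]
  have h5 : 3 * (q * Y) ≤ σ ^ 2 * Y / 4 := by nlinarith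
  have h6 : (2 * q + 3 * s ^ 2) * a ^ 2 ≤ s * σ / 2 * a ^ 2 := by
    refine mul_le_mul_of_nonneg_right ?_ (sq_nonneg a)
    nlinarith
  rw [e]
  nlinarith [mul_nonneg (sq_nonneg σ) hY]

/-- Inserts the critical point relation a = −xLw and divides by xL. The coefficient 5/4 exceeds 1,
which is what later absorbs the factor L + 1 produced by the double logarithm; likewise 2 against
5/4 in the other directions. -/
theorem third_order_total_bound {Y S R σ s q g x w L K D W : ℝ}
    (hY : 0 ≤ Y) (hR : R ^ 2 ≤ q * Y) (hS : σ * S = g - s * (-(x * L * w)) + R)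
    (hs : σ - x = s) (hs0 : 0 ≤ s) (hq : 0 ≤ q) (hqσ : 12 * q ≤ σ ^ 2)
    (hqK : 8 * q ≤ 1 / K) (hK : 1 ≤ K) (hKs : 1 / K ≤ s * σ) (hsσ : 12 * s ≤ σ) (hx : 1 ≤ x)
    (hL : 8 ≤ L) (hg : g ^ 2 ≤ 4 * K ^ 2 * x ^ 2)
    (hD : Y - 2 * (-(x * L * w)) * S - S ^ 2 + 2 * (x * L) ^ 2 * W ≤ D) :
    2 * x * L * W + 5 / 4 * L * s * w ^ 2 - 64 * K ^ 3 * x / L - 12 * K ^ 2 ≤ D / (x * L) := by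
  have hxσ : x ≤ σ := by linarith
  have hσ : 0 < σ := by linarith
  have hx0 : 0 < x := by linarith
  have hL0 : 0 < L := by linarith
  have hK0 : 0 < K := by linarith
  have hKs' : 1 ≤ K * (s * σ) := by
    have := mul_le_mul_of_nonneg_left hKs hK0.le
    rwa [mul_one_div_cancel hK0.ne'] at this
  have h1 := third_order_bound (a := -(x * L * w)) hY hR hS hσ hs0 hq hqσ hqK hKs hsσ
  set Q := Y - 2 * (-(x * L * w)) * S - S ^ 2
  have hgσ : g ^ 2 ≤ 4 * K ^ 2 * σ ^ 2 := by
    refine hg.trans ?_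
    have : x ^ 2 ≤ σ ^ 2 := by gcongr
    exact mul_le_mul_of_nonneg_left this (by positivity)
  -- the mixed term is absorbed by half of the margin
  have h2 : 2 * |w * g| * (σ * L) ≤ L ^ 2 * (s * σ ^ 2 * w ^ 2) / 8 + 8 * (K * σ) * g ^ 2 := by
    have h3 : (2 * |w * g| * (σ * L)) ^ 2 ≤
        (L ^ 2 * (s * σ ^ 2 * w ^ 2) / 8 + 8 * (K * σ) * g ^ 2) ^ 2 := by
      have e : (2 * |w * g| * (σ * L)) ^ 2 = 4 * (w ^ 2 * g ^ 2) * (σ ^ 2 * L ^ 2) := by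
        rw [mul_pow, mul_pow, sq_abs]; ring
      rw [e]
      have h4 : 4 * (w ^ 2 * g ^ 2) * (σ ^ 2 * L ^ 2) ≤
          4 * (w ^ 2 * g ^ 2) * (σ ^ 2 * L ^ 2) * (K * (s * σ)) :=
        le_mul_of_one_le_right (by positivity) hKs'
      nlinarith only [h4, sq_nonneg (L ^ 2 * (s * σ ^ 2 * w ^ 2) / 8 - 8 * (K * σ) * g ^ 2)]
    exact (abs_le_of_sq_le_sq' h3 (by positivity)).2
  have h5 : x * L * (5 / 4 * L * s * w ^ 2 - 64 * K ^ 3 * x / L - 12 * K ^ 2) * σ ^ 2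
      ≤ σ ^ 2 * Q := by
    refine le_trans ?_ h1
    have hxs : 11 / 12 * σ ≤ x := by linarith
    have e1 : x * L * (5 / 4 * L * s * w ^ 2 - 64 * K ^ 3 * x / L - 12 * K ^ 2) * σ ^ 2
        = 5 / 4 * x * L ^ 2 * (s * σ ^ 2 * w ^ 2) - 64 * K ^ 3 * x ^ 2 * σ ^ 2
          - 12 * K ^ 2 * x * L * σ ^ 2 := by
      field_simp
    rw [e1]
    have h6 := mul_le_mul_of_nonneg_left h2 hx0.le
    have h7 : -(x * (2 * |w * g| * (σ * L))) ≤ 2 * (x * L * w) * g * σ := by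
      have h10 := neg_abs_le (w * g)
      nlinarith only [mul_le_mul_of_nonneg_left h10 (show 0 ≤ 2 * (x * L * σ) by positivity)]
    have h8 : 8 * (K * σ) * g ^ 2 * x ≤ 64 * K ^ 3 * x ^ 2 * σ ^ 2 := by
      have := mul_le_mul_of_nonneg_left hgσ (show 0 ≤ 8 * (K * σ) * x by positivity)
      have h9 : K ^ 3 * x * σ ^ 2 * σ ≤ K ^ 3 * x * σ ^ 2 * (2 * x) :=
        mul_le_mul_of_nonneg_left (by linarith) (by positivity)
      nlinarith only [this, h9]
    have h11 : 3 * g ^ 2 ≤ 12 * K ^ 2 * x * L * σ ^ 2 := by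
      have hxL : 1 ≤ x * L := by nlinarith only [hx, hL]
      have := le_mul_of_one_le_right (show 0 ≤ 12 * K ^ 2 * σ ^ 2 by positivity) hxL
      nlinarith only [this, hgσ]
    have h12 : 11 / 8 * x * L ^ 2 * (s * σ ^ 2 * w ^ 2)
        ≤ 3 / 2 * (s * σ * (-(x * L * w)) ^ 2) := by
      have := mul_le_mul_of_nonneg_left hxs (show 0 ≤ 3 / 2 * x * L ^ 2 * s * σ * w ^ 2 by positivity)
      nlinarith only [this]
    nlinarith only [h6, h7, h8, h11, h12]
  have h6 : x * L * (5 / 4 * L * s * w ^ 2 - 64 * K ^ 3 * x / L - 12 * K ^ 2) ≤ Q := by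
    have : 0 < σ ^ 2 := by positivity
    nlinarith only [h5, this]
  rw [le_div_iff₀ (by positivity)]
  nlinarith only [h6, hD]

theorem sum_abs_le_card_mul {n : ℕ} {a : Fin n → ℝ} {c : ℝ} (h : ∀ i, |a i| ≤ c) :
    |∑ i, a i| ≤ n * c := by
  refine (Finset.abs_sum_le_sum_abs _ _).trans ((Finset.sum_le_sum fun i _ => h i).trans ?_)
  simp

/-- Dictionary: l are the eigenvalues, x the coordinates of the point, v the first derivatives of u,
w the gradient of 2 log ρ + weight, g_i = q_i l_i + r_i the derivatives of f along the jet with q_i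
= f_{p_i}, y_i = u_iio, T = Σu_ijo², and G the second derivative of f along the jet. All that is not
favourable is of order l_o/ρ². -/
theorem max_point_reduction {n : ℕ} {K α β ρ f T G L : ℝ} {l w x v q r g y : Fin n → ℝ}
    {o : Fin n} (hK : 1 ≤ K) (hα : 0 ≤ α) (hβ : 0 ≤ β) (hρ : 0 < ρ)
    (hρx : ρ = 3 / 4 - ∑ i, x i ^ 2)
    (hl : ∀ i, l i ≤ l o) (hσ0 : 0 < ∑ i, l i) (hfK : 1 / K ≤ f) (hfK' : f ≤ K)
    (hs : (∑ i, l i) - l o ≤ 1 / 12) (hq : ∑ i ∈ Finset.univ.erase o, l i ^ 2 ≤ 1 / (64 * K))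
    (hfs : f ≤ ((∑ i, l i) - l o) * ∑ i, l i)
    (hx1 : 1 ≤ l o) (hxB : n * ((α * K + β) * K) + 2 * β * K + 12 * K ^ 2 ≤ l o)
    (hL : 8 + K + 64 * K ^ 3 ≤ L)
    (hv : ∀ i, |v i| ≤ K) (hqq : ∀ i, |q i| ≤ K) (hr : ∀ i, |r i| ≤ K)
    (hg : ∀ i, g i = q i * l i + r i)
    (hw : ∀ i, w i = -4 * x i / ρ + (α * v i - β * x i) * l i)
    (hyo : y o = -(l o * L * w o)) (hy : ∑ i, ((∑ j, l j) - l i) * y i = g o)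
    (hG : ∑ i, q i * (-(l o * L * w i)) - K * l o ^ 2 ≤ G)
    (hT : ∑ i, y i ^ 2 + 2 * ∑ i ∈ Finset.univ.erase o, (l o * L * w i) ^ 2 ≤ T)
    (hmain : -(4 / ρ) * ∑ i, ((∑ j, l j) - l i) - 8 / ρ ^ 2 * ∑ i, ((∑ j, l j) - l i) * x i ^ 2
      + α * (∑ i, ((∑ j, l j) - l i) * l i ^ 2 + ∑ i, v i * g i) - β * (2 * f + ∑ i, x i * g i)
      + (G + T - (∑ i, y i) ^ 2) / (l o * L)
      - (L + 1) * ∑ i, ((∑ j, l j) - l i) * w i ^ 2 ≤ 0) :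
    α * l o / (2 * K) + L / 2 * l o * ∑ i ∈ Finset.univ.erase o, w i ^ 2
      + L / 8 * ((∑ i, l i) - l o) * w o ^ 2 ≤ (8 * n + 34 + 4 * n * K) * (l o / ρ ^ 2) := by
  have hK0 : 0 < K := by linarith
  have hK3 : 0 < K ^ 3 := by positivity
  have hL8 : 8 ≤ L := by linarith
  have hL0 : 0 < L := by linarith
  have hl0 : 0 < l o := by linarith
  have hxsum : ∑ i, x i ^ 2 ≤ 3 / 4 := by linarith
  have hρ1 : ρ ≤ 1 := by
    have := Finset.sum_nonneg fun i (_ : i ∈ Finset.univ) => sq_nonneg (x i)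
    linarith
  have hxi : ∀ i, |x i| ≤ 1 := fun i => by
    rw [← sq_le_one_iff_abs_le_one]
    exact (Finset.single_le_sum (f := fun i => x i ^ 2) (fun i _ => sq_nonneg _)
      (Finset.mem_univ i)).trans (by linarith)
  have hK1 : 1 / K ≤ 1 := by rw [div_le_one hK0]; exact hK
  have hKp : 0 < 1 / K := by positivity
  have hq0 : 0 ≤ ∑ i ∈ Finset.univ.erase o, l i ^ 2 := Finset.sum_nonneg fun i _ => sq_nonneg _
  have hqK : 64 * ∑ i ∈ Finset.univ.erase o, l i ^ 2 ≤ 1 / K := by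
    have : 1 / (64 * K) = 1 / K / 64 := by field_simp
    linarith
  have hli : ∀ i ∈ Finset.univ.erase o, |l i| ≤ 1 / 8 := fun i hi => by
    refine abs_le_of_sq_le_sq ?_ (by norm_num)
    have := Finset.single_le_sum (f := fun i => l i ^ 2) (fun i _ => sq_nonneg _) hi
    linarith
  obtain ⟨s, hsd⟩ : ∃ s, (∑ i, l i) - l o = s := ⟨_, rfl⟩
  obtain ⟨σ, hσd⟩ : ∃ σ, ∑ i, l i = σ := ⟨_, rfl⟩
  simp only [hσd] at hsd hs hfs hy hmain hσ0 ⊢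
  rw [hsd] at hs hfs ⊢
  have hs0 : 0 < s := by
    by_contra h
    push Not at h
    nlinarith only [hfs, hfK, hKp, hσ0, h]
  have hσl : l o ≤ σ := by linarith
  have hσ2 : σ ≤ 2 * l o := by linarith
  have hF0 : ∀ i, 0 ≤ σ - l i := fun i => by linarith [hl i]
  have b1 : ∑ i, (σ - l i) ≤ 2 * n * l o := by
    rw [Finset.sum_sub_distrib, hσd]
    simp
    have : (0:ℝ) ≤ n := Nat.cast_nonneg n
    nlinarith only [this, hσ2, hσl, hl0]
  have hF2 : ∀ i, σ - l i ≤ 4 * l o := fun i => by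
    by_cases hi : i = o
    · rw [hi]; linarith
    · have := (abs_le.1 (hli i (by simp [hi]))).1
      linarith
  have b2 : ∑ i, (σ - l i) * x i ^ 2 ≤ 4 * l o := by
    calc ∑ i, (σ - l i) * x i ^ 2 ≤ ∑ i, 4 * l o * x i ^ 2 :=
          Finset.sum_le_sum fun i _ => mul_le_mul_of_nonneg_right (hF2 i) (sq_nonneg _)
      _ = 4 * l o * ∑ i, x i ^ 2 := by rw [Finset.mul_sum]
      _ ≤ 4 * l o := by nlinarith only [hxsum, hl0]
  have b3 : l o / (2 * K) ≤ ∑ i, (σ - l i) * l i ^ 2 := by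
    have h1 : (σ - l o) * l o ^ 2 ≤ ∑ i, (σ - l i) * l i ^ 2 :=
      Finset.single_le_sum (f := fun i => (σ - l i) * l i ^ 2)
        (fun i _ => mul_nonneg (hF0 i) (sq_nonneg _)) (Finset.mem_univ o)
    refine le_trans ?_ h1
    rw [hsd]
    have e : l o / (2 * K) = 1 / K * l o / 2 := by field_simp
    rw [e]
    have h2 : 1 / K ≤ s * (2 * l o) :=
      (hfK.trans hfs).trans (mul_le_mul_of_nonneg_left hσ2 hs0.le)
    nlinarith only [mul_le_mul_of_nonneg_right h2 hl0.le]
  -- The third derivatives in the second derivative of f bring in −Σq_i w_i, whose part of order l_i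
  -- cancels exactly against the derivatives of f produced by the weight. Only r_i and the cutoff
  -- contribute.
  have b4 : -(n * ((α * K + β) * K + 4 * K / ρ)) ≤
      α * ∑ i, v i * g i - β * ∑ i, x i * g i - ∑ i, q i * w i := by
    have e : α * ∑ i, v i * g i - β * ∑ i, x i * g i - ∑ i, q i * w i
        = ∑ i, ((α * v i - β * x i) * r i + 4 * q i * x i / ρ) := by
      rw [Finset.mul_sum, Finset.mul_sum, ← Finset.sum_sub_distrib, ← Finset.sum_sub_distrib]
      refine Finset.sum_congr rfl fun i _ => ?_
      rw [hw, hg]; ring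
    rw [e]
    refine (abs_le.1 (sum_abs_le_card_mul fun i => ?_)).1
    refine (abs_add_le _ _).trans (add_le_add ?_ ?_)
    · rw [abs_mul]
      refine mul_le_mul ((abs_sub _ _).trans ?_) (hr i) (abs_nonneg _) (by positivity)
      rw [abs_mul, abs_mul, abs_of_nonneg hα, abs_of_nonneg hβ]
      have h1 := mul_le_mul_of_nonneg_left (hv i) hα
      have h2 := mul_le_mul_of_nonneg_left (hxi i) hβ
      linarith
    · rw [abs_div, abs_of_pos hρ, abs_mul, abs_mul]
      refine div_le_div_of_nonneg_right ?_ hρ.le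
      have := mul_le_mul (hqq i) (hxi i) (abs_nonneg _) hK0.le
      rw [abs_of_pos (by norm_num : (0:ℝ) < 4)]
      linarith
  have b5 : -∑ i, q i * w i - K * l o / L ≤ G / (l o * L) := by
    rw [le_div_iff₀ (by positivity)]
    refine le_trans (le_of_eq ?_) hG
    have : ∑ i, q i * (-(l o * L * w i)) = -(∑ i, q i * w i) * (l o * L) := by
      rw [← Finset.sum_neg_distrib, Finset.sum_mul]
      exact Finset.sum_congr rfl fun i _ => by ring
    rw [this]
    field_simp
  have b7 : ∑ i, (σ - l i) * w i ^ 2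
      ≤ s * w o ^ 2 + 5 / 4 * l o * ∑ i ∈ Finset.univ.erase o, w i ^ 2 := by
    rw [← Finset.add_sum_erase Finset.univ _ (Finset.mem_univ o), hsd, Finset.mul_sum]
    gcongr with i hi
    have := (abs_le.1 (hli i hi)).1
    linarith
  have b6 : 2 * l o * L * ∑ i ∈ Finset.univ.erase o, w i ^ 2 + 5 / 4 * L * s * w o ^ 2
      - 64 * K ^ 3 * l o / L - 12 * K ^ 2 ≤ (T - (∑ i, y i) ^ 2) / (l o * L) := by
    refine third_order_total_bound (Y := ∑ i ∈ Finset.univ.erase o, y i ^ 2)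
      (S := ∑ i ∈ Finset.univ.erase o, y i) (R := ∑ i ∈ Finset.univ.erase o, l i * y i)
      (σ := σ) (q := ∑ i ∈ Finset.univ.erase o, l i ^ 2) (g := g o)
      (Finset.sum_nonneg fun i _ => sq_nonneg _) (Finset.sum_mul_sq_le_sq_mul_sq _ _ _) ?_ hsd
      hs0.le hq0 ?_ (by linarith) hK (hfK.trans hfs) (by linarith) hx1 hL8 ?_ ?_
    · rw [← hy, ← hyo, ← hsd, ← Finset.add_sum_erase Finset.univ _ (Finset.mem_univ o),
        Finset.mul_sum, add_sub_cancel_left, ← Finset.sum_add_distrib]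
      exact Finset.sum_congr rfl fun i _ => by ring
    · nlinarith only [hqK, hK1, hσl, hx1]
    · rw [hg]
      have h1 : |q o * l o + r o| ≤ 2 * K * l o := by
        refine (abs_add_le _ _).trans ?_
        rw [abs_mul, abs_of_pos hl0]
        have h2 := mul_le_mul_of_nonneg_right (hqq o) hl0.le
        have h3 := hr o
        nlinarith only [h2, h3, hx1, hK0]
      have := sq_le_sq' (by linarith [(abs_le.1 h1).1]) (abs_le.1 h1).2
      nlinarith only [this]
    · rw [← Finset.add_sum_erase Finset.univ y (Finset.mem_univ o)]
      rw [← Finset.add_sum_erase Finset.univ (fun i => y i ^ 2) (Finset.mem_univ o)] at hT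
      simp only [mul_pow _ (w _) 2, ← Finset.mul_sum] at hT
      rw [← hyo]
      linarith
  obtain ⟨W, hW⟩ : ∃ W, ∑ i ∈ Finset.univ.erase o, w i ^ 2 = W := ⟨_, rfl⟩
  have hW0 : 0 ≤ W := hW ▸ Finset.sum_nonneg fun i _ => sq_nonneg _
  rw [hW] at b6 b7 ⊢
  have hn : (0:ℝ) ≤ n := Nat.cast_nonneg n
  have c1 : l o ≤ l o / ρ ^ 2 := by
    rw [le_div_iff₀ (by positivity)]
    nlinarith only [mul_le_mul_of_nonneg_left (pow_le_one₀ hρ.le hρ1 : ρ ^ 2 ≤ 1) hl0.le]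
  have c2 : l o / ρ ≤ l o / ρ ^ 2 := by
    refine div_le_div_of_nonneg_left hl0.le (by positivity) ?_
    nlinarith only [hρ, hρ1]
  have c3 : 1 / ρ ≤ l o / ρ ^ 2 := le_trans (div_le_div_of_nonneg_right hx1 hρ.le) c2
  have c4 : K * l o / L + 64 * K ^ 3 * l o / L ≤ l o := by
    rw [← add_div, div_le_iff₀ hL0]
    nlinarith only [hL, hl0]
  have d1 : 4 / ρ * ∑ i, (σ - l i) ≤ 8 * n * (l o / ρ ^ 2) := by
    have h1 := mul_le_mul_of_nonneg_left b1 (show 0 ≤ 4 / ρ by positivity)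
    have h2 := mul_le_mul_of_nonneg_left c2 (show 0 ≤ 8 * (n:ℝ) by positivity)
    have e : 4 / ρ * (2 * n * l o) = 8 * n * (l o / ρ) := by ring
    linarith
  have d2 : 8 / ρ ^ 2 * ∑ i, (σ - l i) * x i ^ 2 ≤ 32 * (l o / ρ ^ 2) := by
    have h1 := mul_le_mul_of_nonneg_left b2 (show 0 ≤ 8 / ρ ^ 2 by positivity)
    have e : 8 / ρ ^ 2 * (4 * l o) = 32 * (l o / ρ ^ 2) := by ring
    linarith
  have d3 : n * (4 * K / ρ) ≤ 4 * n * K * (l o / ρ ^ 2) := by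
    have h2 := mul_le_mul_of_nonneg_left c3 (show 0 ≤ 4 * (n:ℝ) * K by positivity)
    have e : n * (4 * K / ρ) = 4 * n * K * (1 / ρ) := by ring
    linarith
  have d4 := mul_le_mul_of_nonneg_left b3 hα
  have d5 := mul_le_mul_of_nonneg_left b7 (show 0 ≤ L + 1 by linarith)
  have d6 := mul_le_mul_of_nonneg_left hfK' hβ
  have e1 : (G + T - (∑ i, y i) ^ 2) / (l o * L)
      = G / (l o * L) + (T - (∑ i, y i) ^ 2) / (l o * L) := by ring
  have e2 : α * l o / (2 * K) = α * (l o / (2 * K)) := by ring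
  -- With L ≥ 8, the gains 2L and 5L/4 exceed the losses 5(L+1)/4 and L+1 by at least L/2 and L/8.
  have d7 : L / 2 * l o * W ≤ (2 * L - 5 / 4 * (L + 1)) * (l o * W) := by
    nlinarith only [mul_nonneg (sub_nonneg.2 hL8) (mul_nonneg hl0.le hW0), mul_nonneg hl0.le hW0]
  have d8 : L / 8 * s * w o ^ 2 ≤ (5 / 4 * L - (L + 1)) * (s * w o ^ 2) := by
    nlinarith only [mul_nonneg (sub_nonneg.2 hL8) (mul_nonneg hs0.le (sq_nonneg (w o)))]
  rw [e1] at hmain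
  rw [e2]
  linarith only [hmain, b4, b5, b6, c1, c4, d1, d2, d3, d4, d5, d6, d7, d8, hxB]

/-- α is chosen so that αl_o/(2K) = (4N + 1)l_o, which contradicts the inequality when ρ ≥ 1/2.
Otherwise |x|² > 1/4, so some |x_i| ≥ 1/(2n), and β is chosen so that β|x_i| ≥ αK + 1 for such i. -/
theorem max_point_cases {n : ℕ} {K N α β ρ L s : ℝ} {l w x v : Fin n → ℝ} {o : Fin n}
    (hK : 1 ≤ K) (hN : 0 ≤ N) (hα : α = 8 * N * K + 2 * K) (hβ : β = (α * K + 1) * (2 * n))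
    (hρ : 0 < ρ) (hρx : ρ = 3 / 4 - ∑ i, x i ^ 2) (hl0 : 1 ≤ l o)
    (hq : ∀ i ∈ Finset.univ.erase o, n * (α * K + β) * |l i| ≤ 1)
    (hs : 1 / (2 * K) ≤ s * l o) (hL : 2 * n ^ 2 * N < L) (hv : ∀ i, |v i| ≤ K)
    (hw : ∀ i, w i = -4 * x i / ρ + (α * v i - β * x i) * l i)
    (hmain : α * l o / (2 * K) + L / 2 * l o * ∑ i ∈ Finset.univ.erase o, w i ^ 2
      + L / 8 * s * w o ^ 2 ≤ N * (l o / ρ ^ 2)) :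
    ρ ^ 2 * L ≤ 16 * K * N := by
  have hK0 : 0 < K := by linarith
  have hl : 0 < l o := by linarith
  have hL0 : 0 < L := lt_of_le_of_lt (by positivity) hL
  have hα0 : 0 < α := by rw [hα]; positivity
  have hn1 : (1:ℝ) ≤ n := by
    have := o.pos
    exact_mod_cast this
  have hn0 : (0:ℝ) < n := by linarith
  have hβ0 : 0 < β := by rw [hβ]; positivity
  have hρ1 : ρ ≤ 1 := by
    have := Finset.sum_nonneg fun i (_ : i ∈ Finset.univ) => sq_nonneg (x i)
    linarith
  have hW0 : 0 ≤ ∑ i ∈ Finset.univ.erase o, w i ^ 2 := Finset.sum_nonneg fun i _ => sq_nonneg _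
  have hs0 : 0 < s := by
    have h1 : 0 < s * l o := lt_of_lt_of_le (by positivity) hs
    exact pos_of_mul_pos_left h1 hl.le
  have t1 : 0 ≤ α * l o / (2 * K) := by positivity
  have t2 : 0 ≤ L / 2 * l o * ∑ i ∈ Finset.univ.erase o, w i ^ 2 := by positivity
  have t3 : 0 ≤ L / 8 * s * w o ^ 2 := by positivity
  by_cases hx : ∑ i, x i ^ 2 ≤ 1 / 4
  · exfalso
    have h1 : 1 / 2 ≤ ρ := by linarith
    have h2 : l o / ρ ^ 2 ≤ 4 * l o := by
      rw [div_le_iff₀ (by positivity)]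
      nlinarith only [mul_le_mul h1 h1 (by norm_num) hρ.le, hl]
    have h3 : α * l o / (2 * K) ≤ N * (4 * l o) := by
      have := mul_le_mul_of_nonneg_left h2 hN
      linarith
    have h4 : α * l o / (2 * K) = 4 * N * l o + l o := by
      rw [hα]; field_simp; ring
    nlinarith only [h3, h4, hl]
  obtain ⟨i, hi⟩ : ∃ i, 1 / (2 * n) ≤ |x i| := by
    by_contra! h
    refine hx ?_
    have h1 : ∀ i, x i ^ 2 ≤ 1 / (4 * n ^ 2) := fun i => by
      have h2 := pow_le_pow_left₀ (abs_nonneg _) (h i).le 2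
      rw [sq_abs] at h2
      refine h2.trans (le_of_eq ?_)
      field_simp; norm_num
    refine (Finset.sum_le_sum fun i _ => h1 i).trans ?_
    simp only [Finset.sum_const, Finset.card_univ, Fintype.card_fin, nsmul_eq_mul]
    have : n * (1 / (4 * (n:ℝ) ^ 2)) = 1 / (4 * n) := by field_simp
    rw [this]
    exact one_div_le_one_div_of_le (by norm_num) (by linarith)
  have hi' : 1 ≤ 2 * n * |x i| := by
    rw [div_le_iff₀ (by positivity)] at hi
    linarith
  have hρ2 : 0 < ρ ^ 2 := by positivity
  by_cases hio : i = o
  · subst hio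
    -- The contributions of the cutoff and of β to w_i have the same sign, so the cutoff cannot
    -- cancel the β-term.
    have h1 : l i ≤ |w i| := by
      have h2 : β * (2 * |x i|) * l i ≤ |(4 / ρ + β * l i) * x i| * 2 := by
        rw [abs_mul, abs_of_pos (show 0 < 4 / ρ + β * l i by positivity)]
        have : 0 ≤ 4 / ρ * |x i| := by positivity
        nlinarith only [this]
      have h3 : |(4 / ρ + β * l i) * x i| ≤ |w i| + |α * v i * l i| := by
        have e : (4 / ρ + β * l i) * x i = α * v i * l i - w i := by rw [hw]; ring
        rw [e]
        exact (abs_sub _ _).trans (add_comm _ _).le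
      have h4 : |α * v i * l i| ≤ α * K * l i := by
        rw [abs_mul, abs_mul, abs_of_pos hα0, abs_of_pos hl]
        have := mul_le_mul_of_nonneg_left (hv i) hα0.le
        exact mul_le_mul_of_nonneg_right this hl.le
      have h5 : 2 * (α * K + 1) ≤ β * (2 * |x i|) := by
        rw [hβ]
        have := mul_le_mul_of_nonneg_left hi' (show 0 ≤ 2 * (α * K + 1) by positivity)
        linarith
      nlinarith only [h2, h3, h4, mul_le_mul_of_nonneg_right h5 hl.le]
    have h2 : l i ^ 2 ≤ w i ^ 2 := by
      rw [← sq_abs (w i)]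
      exact pow_le_pow_left₀ hl.le h1 2
    have h3 : L / 8 * (1 / (2 * K)) * l i ≤ N * (l i / ρ ^ 2) := by
      have h4 := mul_le_mul_of_nonneg_left h2 (show 0 ≤ L / 8 * s by positivity)
      have h5 := mul_le_mul_of_nonneg_left hs (show 0 ≤ L / 8 * l i by positivity)
      nlinarith only [h4, h5, hmain, t1, t2]
    have e1 : L / 8 * (1 / (2 * K)) * l i = L * l i / (16 * K) := by ring
    have e2 : N * (l i / ρ ^ 2) = N * l i / ρ ^ 2 := by ring
    rw [e1, e2, div_le_div_iff₀ (by positivity) hρ2] at h3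
    refine le_of_mul_le_mul_right ?_ hl
    linarith
  -- In a direction other than the top one l_i is tiny, so w_i is essentially −4x_i/ρ and the gain
  -- L·l_o·w_i² already exceeds N·l_o/ρ².
  · exfalso
    have him : i ∈ Finset.univ.erase o := by simp [hio]
    have h1 : 1 ≤ n * (ρ * |w i|) := by
      have h2 : |4 * x i| ≤ ρ * |w i| + ρ * |(α * v i - β * x i) * l i| := by
        have e : 4 * x i = ρ * ((α * v i - β * x i) * l i - w i) := by
          rw [hw]; field_simp; ring
        rw [e, abs_mul, abs_of_pos hρ, ← mul_add]
        exact mul_le_mul_of_nonneg_left ((abs_sub _ _).trans (add_comm _ _).le) hρ.le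
      have hxi : |x i| ≤ 1 := by
        rw [← sq_le_one_iff_abs_le_one]
        have := Finset.single_le_sum (f := fun i => x i ^ 2) (fun i _ => sq_nonneg _)
          (Finset.mem_univ i)
        linarith
      have h3 : |(α * v i - β * x i) * l i| ≤ (α * K + β) * |l i| := by
        rw [abs_mul]
        refine mul_le_mul_of_nonneg_right ((abs_sub _ _).trans ?_) (abs_nonneg _)
        rw [abs_mul, abs_mul, abs_of_pos hα0, abs_of_pos hβ0]
        have h1 := mul_le_mul_of_nonneg_left (hv i) hα0.le
        have h2 := mul_le_mul_of_nonneg_left hxi hβ0.le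
        linarith
      have h4 : ρ * |(α * v i - β * x i) * l i| ≤ (α * K + β) * |l i| :=
        (mul_le_of_le_one_left (abs_nonneg _) hρ1).trans h3
      rw [abs_mul, abs_of_pos (by norm_num : (0:ℝ) < 4)] at h2
      have h5 := hq i him
      have h6 := mul_le_mul_of_nonneg_left (h2.trans (add_le_add_right h4 _)) hn0.le
      nlinarith only [h6, h5, hi']
    have h2 : 1 ≤ n ^ 2 * (ρ ^ 2 * w i ^ 2) := by
      have := one_le_pow₀ h1 (n := 2)
      rwa [mul_pow, mul_pow, sq_abs] at this
    have h3 : w i ^ 2 ≤ ∑ i ∈ Finset.univ.erase o, w i ^ 2 :=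
      Finset.single_le_sum (f := fun i => w i ^ 2) (fun i _ => sq_nonneg _) him
    have h4 : L / 2 * l o * w i ^ 2 ≤ N * (l o / ρ ^ 2) := by
      have := mul_le_mul_of_nonneg_left h3 (show 0 ≤ L / 2 * l o by positivity)
      linarith
    have e2 : N * (l o / ρ ^ 2) = N * l o / ρ ^ 2 := by ring
    rw [e2, le_div_iff₀ hρ2] at h4
    have h5 : L / 2 * (ρ ^ 2 * w i ^ 2) ≤ N := by
      refine le_of_mul_le_mul_right ?_ hl
      linarith
    have h6 := mul_le_mul_of_nonneg_left h5 (show 0 ≤ (n:ℝ) ^ 2 by positivity)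
    have h7 := mul_le_mul_of_nonneg_left h2 (show 0 ≤ L / 2 by positivity)
    linarith

theorem exists_max_point_bound (n : ℕ) {K A : ℝ} (hK : 1 ≤ K) (hA : 0 ≤ A) :
    ∃ α β Λ C : ℝ, 0 ≤ α ∧ 0 ≤ β ∧ Real.exp 1 < Λ ∧ 0 ≤ C ∧
      ∀ (l w x v q r g y : Fin n → ℝ) (o : Fin n) (ρ f T G : ℝ),
        0 < ρ → ρ = 3 / 4 - ∑ i, x i ^ 2 →
        (∀ i, l i ≤ l o) → 0 < ∑ i, l i → 1 / K ≤ f → f ≤ K →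
        (∑ i, l i) ^ 2 - ∑ i, l i ^ 2 = 2 * f →
        -(6 * A) ≤ (∑ i, l i) ^ 3 - 3 * (∑ i, l i) * (∑ i, l i ^ 2) + 2 * ∑ i, l i ^ 3 →
        Λ ≤ l o →
        (∀ i, |v i| ≤ K) → (∀ i, |q i| ≤ K) → (∀ i, |r i| ≤ K) →
        (∀ i, g i = q i * l i + r i) →
        (∀ i, w i = -4 * x i / ρ + (α * v i - β * x i) * l i) →
        y o = -(l o * Real.log (l o) * w o) →
        ∑ i, ((∑ j, l j) - l i) * y i = g o →
        ∑ i, q i * (-(l o * Real.log (l o) * w i)) - K * l o ^ 2 ≤ G →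
        ∑ i, y i ^ 2 + 2 * ∑ i ∈ Finset.univ.erase o, (l o * Real.log (l o) * w i) ^ 2 ≤ T →
        -(4 / ρ) * ∑ i, ((∑ j, l j) - l i)
          - 8 / ρ ^ 2 * ∑ i, ((∑ j, l j) - l i) * x i ^ 2
          + α * (∑ i, ((∑ j, l j) - l i) * l i ^ 2 + ∑ i, v i * g i)
          - β * (2 * f + ∑ i, x i * g i)
          + (G + T - (∑ i, y i) ^ 2) / (l o * Real.log (l o))
          - (Real.log (l o) + 1) * ∑ i, ((∑ j, l j) - l i) * w i ^ 2 ≤ 0 →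
        ρ ^ 2 * Real.log (l o) ≤ C := by
  have hK0 : 0 < K := by linarith
  obtain ⟨N, hN⟩ : ∃ N : ℝ, N = 8 * n + 34 + 4 * n * K := ⟨_, rfl⟩
  have hN0 : 0 ≤ N := by rw [hN]; positivity
  obtain ⟨α, hα⟩ : ∃ α : ℝ, α = 8 * N * K + 2 * K := ⟨_, rfl⟩
  have hα0 : 0 ≤ α := by rw [hα]; positivity
  obtain ⟨β, hβ⟩ : ∃ β : ℝ, β = (α * K + 1) * (2 * n) := ⟨_, rfl⟩
  have hβ0 : 0 ≤ β := by rw [hβ]; positivity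
  -- M measures how small the lower eigenvalues must be for the weight not to disturb w_i; it
  -- depends on α and β, so Λ is chosen after them.
  obtain ⟨M, hM⟩ : ∃ M : ℝ, M = n * (α * K + β) + 1 := ⟨_, rfl⟩
  have hM1 : 1 ≤ M := by
    have : 0 ≤ n * (α * K + β) := by positivity
    linarith
  have hM0 : 0 < M := by linarith
  obtain ⟨Λ₁, h1Λ₁, hgap⟩ := exists_eigenvalue_gap (ε := 1 / (64 * K * M ^ 2)) hA hK0.le
    (by positivity)
  refine ⟨α, β, Λ₁ + Real.exp (8 + K + 64 * K ^ 3 + 2 * n ^ 2 * N) +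
    (n * ((α * K + β) * K) + 2 * β * K + 12 * K ^ 2), 16 * K * N, hα0, hβ0, ?_, by positivity, ?_⟩
  · have h1 : Real.exp 1 < Real.exp (8 + K + 64 * K ^ 3 + 2 * n ^ 2 * N) := by
      refine Real.exp_lt_exp.2 ?_
      have : 0 ≤ K + 64 * K ^ 3 + 2 * n ^ 2 * N := by positivity
      linarith
    have h2 : 0 ≤ n * ((α * K + β) * K) + 2 * β * K + 12 * K ^ 2 := by positivity
    linarith
  intro l w x v q r g y o ρ f T G hρ hρx hl hσ0 hfK hfK' h2 h3 hΛ hv hqq hr hg hw hyo hy hG hT hmain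
  have hB0 : 0 ≤ n * ((α * K + β) * K) + 2 * β * K + 12 * K ^ 2 := by positivity
  have hexp := Real.exp_pos (8 + K + 64 * K ^ 3 + 2 * n ^ 2 * N)
  obtain ⟨g1, g2, g3⟩ := hgap n l o f hl (lt_of_lt_of_le (by positivity) hfK) hfK' hσ0 h2 h3
    (by linarith)
  have hL : 8 + K + 64 * K ^ 3 + 2 * n ^ 2 * N < Real.log (l o) := by
    rw [Real.lt_log_iff_exp_lt (by linarith)]
    linarith
  have hM2 : 1 ≤ M ^ 2 := one_le_pow₀ hM1
  have hε1 : 1 / (64 * K * M ^ 2) ≤ 1 / (64 * K) := by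
    refine one_div_le_one_div_of_le (by positivity) ?_
    exact le_mul_of_one_le_right (by positivity) hM2
  have hε2 : 1 / (64 * K) ≤ 1 / 12 := one_div_le_one_div_of_le (by norm_num) (by linarith)
  have hε3 : 1 / (64 * K * M ^ 2) ≤ (1 / M) ^ 2 := by
    rw [div_pow, one_pow]
    refine one_div_le_one_div_of_le (by positivity) ?_
    exact le_mul_of_one_le_left (by positivity) (by linarith)
  have hKK : 0 ≤ K + 64 * K ^ 3 := by positivity
  have hNN : 0 ≤ 2 * n ^ 2 * N := by positivity
  have hred := max_point_reduction hK hα0 hβ0 hρ hρx hl hσ0 hfK hfK' (by linarith)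
    (g2.trans hε1) g3 (by linarith) (by linarith) (by linarith) hv hqq hr hg hw hyo hy hG hT hmain
  rw [← hN] at hred
  refine max_point_cases hK hN0 hα hβ hρ hρx (by linarith) ?_ ?_ (by linarith) hv hw hred
  · intro i hi
    have h4 : |l i| ≤ 1 / M := by
      refine abs_le_of_sq_le_sq ?_ (by positivity)
      exact (Finset.single_le_sum (f := fun i => l i ^ 2) (fun i _ => sq_nonneg _) hi).trans
        (g2.trans hε3)
    have h5 := mul_le_mul_of_nonneg_left h4 hM0.le
    rw [mul_one_div_cancel hM0.ne', hM] at h5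
    nlinarith only [h5, abs_nonneg (l i)]
  · have h4 : 0 < ∑ i, l i - l o := by
      have h5 : 0 < (∑ i, l i - l o) * ∑ i, l i :=
        lt_of_lt_of_le (lt_of_lt_of_le (by positivity) hfK) g3
      exact pos_of_mul_pos_left h5 hσ0.le
    have h6 : ∑ i, l i ≤ 2 * l o := by linarith
    have h7 := mul_le_mul_of_nonneg_left h6 h4.le
    have e : 1 / (2 * K) = 1 / K / 2 := by field_simp
    rw [e]
    linarith

/-! ### Directional derivatives along lines -/

/-- The derivative of `g` in the constant direction `v`. -/
noncomputable def dirDeriv {E : Type*} [NormedAddCommGroup E] [NormedSpace ℝ E]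
    (g : E → ℝ) (v : E) : E → ℝ := fun x => fderiv ℝ g x v

section DirDeriv

variable {E : Type*} [NormedAddCommGroup E] [NormedSpace ℝ E] {U : Set E} {g h : E → ℝ} {x : E}

theorem contDiffOn_dirDeriv {k m : WithTop ℕ∞} (hg : ContDiffOn ℝ m g U) (hU : IsOpen U)
    (hkm : k + 1 ≤ m) (v : E) : ContDiffOn ℝ k (dirDeriv g v) U :=
  (hg.fderiv_of_isOpen hU hkm).clm_apply contDiffOn_const

theorem hasDerivAt_line (hg : DifferentiableAt ℝ g x) (v : E) :
    HasDerivAt (fun t : ℝ => g (x + t • v)) (dirDeriv g v x) 0 := by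
  have h1 : HasDerivAt (fun t : ℝ => x + t • v) v 0 := by
    simpa using ((hasDerivAt_id (0 : ℝ)).smul_const v).const_add x
  have h2 : HasFDerivAt g (fderiv ℝ g x) (x + (0 : ℝ) • v) := by
    simpa using hg.hasFDerivAt
  exact h2.comp_hasDerivAt 0 h1

theorem hasDerivAt_line_of_contDiffOn {m : WithTop ℕ∞} (hg : ContDiffOn ℝ m g U) (hm : 1 ≤ m)
    (hU : IsOpen U) (hx : x ∈ U) (v : E) :
    HasDerivAt (fun t : ℝ => g (x + t • v)) (dirDeriv g v x) 0 :=
  hasDerivAt_line ((hg.contDiffAt (hU.mem_nhds hx)).differentiableAt (by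
    rintro rfl; simp at hm)) v

theorem continuousAt_line (x v : E) (t : ℝ) : ContinuousAt (fun t : ℝ => x + t • v) t := by
  fun_prop

theorem eventually_line_mem (hU : IsOpen U) (hx : x ∈ U) (v : E) :
    ∀ᶠ t : ℝ in nhds 0, x + t • v ∈ U :=
  (continuousAt_line x v 0).eventually_mem (by simpa using hU.mem_nhds hx)

theorem eq_of_hasDerivAt_line (hU : IsOpen U) (hx : x ∈ U) {v : E} {a c : ℝ} (hgh : EqOn g h U)
    (hg : HasDerivAt (fun t : ℝ => g (x + t • v)) a 0)
    (hh : HasDerivAt (fun t : ℝ => h (x + t • v)) c 0) : a = c := by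
  refine hg.unique (hh.congr_of_eventuallyEq ?_)
  filter_upwards [eventually_line_mem hU hx v] with t ht using hgh ht

theorem dirDeriv_congr (hU : IsOpen U) (hx : x ∈ U) (hgh : EqOn g h U) (v : E) :
    dirDeriv g v x = dirDeriv h v x := by
  rw [dirDeriv, dirDeriv, (hgh.eventuallyEq_of_mem (hU.mem_nhds hx)).fderiv_eq]

theorem dirDeriv_dirDeriv_apply {m : WithTop ℕ∞} (hg : ContDiffOn ℝ m g U) (hm : 2 ≤ m)
    (hU : IsOpen U) (hx : x ∈ U) (v w : E) :
    dirDeriv (dirDeriv g v) w x = fderiv ℝ (fderiv ℝ g) x w v := by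
  have h1 : DifferentiableAt ℝ (fderiv ℝ g) x :=
    ((hg.fderiv_of_isOpen hU (m := 1) (by simpa [one_add_one_eq_two] using hm)).contDiffAt
      (hU.mem_nhds hx)).differentiableAt (by simp)
  have h2 : HasFDerivAt (dirDeriv g v)
      ((ContinuousLinearMap.apply ℝ ℝ v).comp (fderiv ℝ (fderiv ℝ g) x)) x :=
    (ContinuousLinearMap.apply ℝ ℝ v).hasFDerivAt.comp x h1.hasFDerivAt
  rw [dirDeriv, h2.fderiv]
  rfl

theorem dirDeriv_comm {m : WithTop ℕ∞} (hg : ContDiffOn ℝ m g U) (hm : 2 ≤ m)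
    (hU : IsOpen U) (hx : x ∈ U) (v w : E) :
    dirDeriv (dirDeriv g v) w x = dirDeriv (dirDeriv g w) v x := by
  rw [dirDeriv_dirDeriv_apply hg hm hU hx, dirDeriv_dirDeriv_apply hg hm hU hx]
  exact ((hg.contDiffAt (hU.mem_nhds hx)).isSymmSndFDerivAt (by simpa using hm)) w v

theorem hasDerivAt_line_shift {v : E} {t a : ℝ}
    (h : HasDerivAt (fun s : ℝ => g (x + t • v + s • v)) a 0) :
    HasDerivAt (fun s : ℝ => g (x + s • v)) a t := by
  have h2 : HasDerivAt (fun s : ℝ => g (x + t • v + s • v)) a (t - t) := by simpa using h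
  refine (h2.comp_sub_const t t).congr_of_eventuallyEq (Filter.Eventually.of_forall fun s => ?_)
  simp only [sub_smul]
  congr 1
  abel

end DirDeriv

/-- If p'' were positive, 0 would also be a local minimum, so p would be locally constant and p''
would vanish. -/
theorem isLocalMax_second_derivative {p p' : ℝ → ℝ} {p'' : ℝ} (hmax : IsLocalMax p 0)
    (hp : ∀ᶠ t in nhds 0, HasDerivAt p (p' t) t) (hp' : HasDerivAt p' p'' 0) :
    p' 0 = 0 ∧ p'' ≤ 0 := by
  have h0 : p' 0 = 0 := hmax.hasDerivAt_eq_zero hp.self_of_nhds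
  refine ⟨h0, ?_⟩
  by_contra! hpos
  have hd : deriv p =ᶠ[nhds 0] p' := hp.mono fun t ht => ht.deriv
  have hdd : deriv (deriv p) 0 = p'' := by rw [hd.deriv_eq, hp'.deriv]
  have hmin : IsLocalMin p 0 := isLocalMin_of_deriv_deriv_pos (by rw [hdd]; exact hpos)
    (by rw [hd.eq_of_nhds, h0]) hp.self_of_nhds.continuousAt
  have hconst : p =ᶠ[nhds 0] fun _ => p 0 := by
    filter_upwards [hmax, hmin] with t h1 h2 using le_antisymm h1 h2
  have h1 : deriv p =ᶠ[nhds 0] fun _ => 0 := by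
    have := hconst.deriv
    simpa using this
  have h2 := h1.deriv_eq
  rw [hdd] at h2
  simp at h2
  linarith

/-! ### The Hessian and partial derivatives in a fixed frame -/

/-- The pairing of the Hessian matrix with two vectors. -/
theorem inner_hessian {n : ℕ} {u : Sp n → ℝ} {U : Set (Sp n)} {x : Sp n} {m : WithTop ℕ∞}
    (hu : ContDiffOn ℝ m u U) (hm : 2 ≤ m) (hU : IsOpen U) (hx : x ∈ U) (v w : Sp n) :
    inner ℝ v ((hessian u x).toEuclideanLin w) = dirDeriv (dirDeriv u v) w x := by
  rw [dirDeriv_comm hu hm hU hx, dirDeriv_dirDeriv_apply hu hm hU hx]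
  have hv : v = ∑ i, v i • EuclideanSpace.single i (1 : ℝ) := by
    simpa using ((EuclideanSpace.basisFun (Fin n) ℝ).sum_repr v).symm
  have hw : w = ∑ i, w i • EuclideanSpace.single i (1 : ℝ) := by
    simpa using ((EuclideanSpace.basisFun (Fin n) ℝ).sum_repr w).symm
  conv_rhs => rw [hv, hw]
  simp only [map_sum, map_smul, sum_apply, smul_apply,
    smul_eq_mul]
  rw [PiLp.inner_apply, Finset.sum_congr rfl fun _ _ => Finset.mul_sum _ _ _, Finset.sum_comm]
  refine Finset.sum_congr rfl fun i _ => ?_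
  simp only [Matrix.toLpLin_apply, Matrix.mulVec, dotProduct, hessian, Matrix.of_apply,
    iteratedFDeriv_two_apply, RCLike.inner_apply, conj_trivial]
  rw [Finset.sum_mul]
  refine Finset.sum_congr rfl fun j _ => ?_
  simp only [Matrix.cons_val_zero, Matrix.cons_val_one]
  ring

theorem isHermitian_hessian {n : ℕ} {u : Sp n → ℝ} {U : Set (Sp n)} {x : Sp n} {m : WithTop ℕ∞}
    (hu : ContDiffOn ℝ m u U) (hm : 2 ≤ m) (hU : IsOpen U) (hx : x ∈ U) :
    (hessian u x).IsHermitian := by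
  ext i j
  simp only [Matrix.conjTranspose_apply, hessian, Matrix.of_apply, iteratedFDeriv_two_apply,
    star_trivial]
  exact ((hu.contDiffAt (hU.mem_nhds hx)).isSymmSndFDerivAt (by simpa using hm)) _ _

theorem gradient_eq_sum {n : ℕ} (u : Sp n → ℝ) (b : OrthonormalBasis (Fin n) ℝ (Sp n)) (x : Sp n) :
    gradient u x = ∑ k, dirDeriv u (b k) x • b k := by
  conv_lhs => rw [← b.sum_repr' (gradient u x)]
  refine Finset.sum_congr rfl fun k _ => ?_
  rw [real_inner_comm, gradient, InnerProductSpace.toDual_symm_apply, dirDeriv]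

/-- First partial derivatives with respect to the vectors `b k`. -/
noncomputable def partial₁ {n : ℕ} (u : Sp n → ℝ) (b : Fin n → Sp n) (k : Fin n) : Sp n → ℝ :=
  dirDeriv u (b k)

/-- Second partial derivatives with respect to the vectors `b k`. -/
noncomputable def partial₂ {n : ℕ} (u : Sp n → ℝ) (b : Fin n → Sp n) (k l : Fin n) : Sp n → ℝ :=
  dirDeriv (partial₁ u b k) (b l)

/-- Third partial derivatives with respect to the vectors `b k`. -/
noncomputable def partial₃ {n : ℕ} (u : Sp n → ℝ) (b : Fin n → Sp n) (k l m : Fin n) : Sp n → ℝ :=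
  dirDeriv (partial₂ u b k l) (b m)

/-- Fourth partial derivatives with respect to the vectors `b k`. -/
noncomputable def partial₄ {n : ℕ} (u : Sp n → ℝ) (b : Fin n → Sp n) (k l m p : Fin n) :
    Sp n → ℝ :=
  dirDeriv (partial₃ u b k l m) (b p)

section Partials

variable {n : ℕ} {u : Sp n → ℝ} {U : Set (Sp n)} {x : Sp n} (b : Fin n → Sp n)

theorem contDiffOn_partial₁ (hu : ContDiffOn ℝ 4 u U) (hU : IsOpen U) (k : Fin n) :
    ContDiffOn ℝ 3 (partial₁ u b k) U :=
  contDiffOn_dirDeriv hu hU (by norm_num) _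

theorem contDiffOn_partial₂ (hu : ContDiffOn ℝ 4 u U) (hU : IsOpen U) (k l : Fin n) :
    ContDiffOn ℝ 2 (partial₂ u b k l) U :=
  contDiffOn_dirDeriv (contDiffOn_partial₁ b hu hU k) hU (by norm_num) _

theorem contDiffOn_partial₃ (hu : ContDiffOn ℝ 4 u U) (hU : IsOpen U) (k l m : Fin n) :
    ContDiffOn ℝ 1 (partial₃ u b k l m) U :=
  contDiffOn_dirDeriv (contDiffOn_partial₂ b hu hU k l) hU (by norm_num) _

theorem hasDerivAt_line_partial₀ (hu : ContDiffOn ℝ 4 u U) (hU : IsOpen U) (hx : x ∈ U)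
    (k : Fin n) : HasDerivAt (fun t : ℝ => u (x + t • b k)) (partial₁ u b k x) 0 :=
  hasDerivAt_line_of_contDiffOn hu (by norm_num) hU hx _

theorem hasDerivAt_line_partial₁ (hu : ContDiffOn ℝ 4 u U) (hU : IsOpen U) (hx : x ∈ U)
    (k l : Fin n) :
    HasDerivAt (fun t : ℝ => partial₁ u b k (x + t • b l)) (partial₂ u b k l x) 0 :=
  hasDerivAt_line_of_contDiffOn (contDiffOn_partial₁ b hu hU k) (by norm_num) hU hx _

theorem hasDerivAt_line_partial₂ (hu : ContDiffOn ℝ 4 u U) (hU : IsOpen U) (hx : x ∈ U)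
    (k l m : Fin n) :
    HasDerivAt (fun t : ℝ => partial₂ u b k l (x + t • b m)) (partial₃ u b k l m x) 0 :=
  hasDerivAt_line_of_contDiffOn (contDiffOn_partial₂ b hu hU k l) (by norm_num) hU hx _

theorem hasDerivAt_line_partial₃ (hu : ContDiffOn ℝ 4 u U) (hU : IsOpen U) (hx : x ∈ U)
    (k l m p : Fin n) :
    HasDerivAt (fun t : ℝ => partial₃ u b k l m (x + t • b p)) (partial₄ u b k l m p x) 0 :=
  hasDerivAt_line_of_contDiffOn (contDiffOn_partial₃ b hu hU k l m) (by norm_num) hU hx _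

theorem partial₂_comm (hu : ContDiffOn ℝ 4 u U) (hU : IsOpen U) (hx : x ∈ U) (k l : Fin n) :
    partial₂ u b k l x = partial₂ u b l k x :=
  dirDeriv_comm hu (by norm_num) hU hx _ _

theorem partial₃_comm_left (hu : ContDiffOn ℝ 4 u U) (hU : IsOpen U) (hx : x ∈ U)
    (k l m : Fin n) : partial₃ u b k l m x = partial₃ u b l k m x :=
  dirDeriv_congr hU hx (fun _ hy => partial₂_comm b hu hU hy k l) _

theorem partial₃_comm_right (hu : ContDiffOn ℝ 4 u U) (hU : IsOpen U) (hx : x ∈ U)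
    (k l m : Fin n) : partial₃ u b k l m x = partial₃ u b k m l x :=
  dirDeriv_comm (contDiffOn_partial₁ b hu hU k) (by norm_num) hU hx _ _

/-- Lets the equation, differentiated twice in direction o, replace the second derivatives of u_oo.
-/
theorem partial₄_comm_pairs (hu : ContDiffOn ℝ 4 u U) (hU : IsOpen U) (hx : x ∈ U)
    (k l : Fin n) : partial₄ u b k k l l x = partial₄ u b l l k k x := by
  have hL : ∀ i j m p, partial₄ u b i j m p x = partial₄ u b j i m p x := fun i j m p =>
    dirDeriv_congr hU hx (fun _ hy => partial₃_comm_left b hu hU hy i j m) _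
  have hM : ∀ i j m p, partial₄ u b i j m p x = partial₄ u b i m j p x := fun i j m p =>
    dirDeriv_congr hU hx (fun _ hy => partial₃_comm_right b hu hU hy i j m) _
  have hR : ∀ i j m p, partial₄ u b i j m p x = partial₄ u b i j p m x := fun i j m p =>
    dirDeriv_comm (contDiffOn_partial₂ b hu hU i j) le_rfl hU hx _ _
  rw [hM, hL, hR, hM]

end Partials

/-! ### Differentiating the equation -/

section Equation

variable {n : ℕ} {Ω : Set (Jet n)} {f : Jet n → ℝ} {u : Sp n → ℝ} {x : Sp n}

theorem IsSolution.contDiffOn_ball (h : IsSolution Ω f u) : ContDiffOn ℝ 4 u (ball 0 1) :=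
  h.contDiffOn_u.mono ball_subset_closedBall

theorem IsSolution.isHermitian_hessian (h : IsSolution Ω f u) (hx : x ∈ ball (0 : Sp n) 1) :
    (hessian u x).IsHermitian :=
  SigmaTwo.isHermitian_hessian h.contDiffOn_ball (by norm_num) isOpen_ball hx

theorem IsSolution.inner_hessian (h : IsSolution Ω f u) (hx : x ∈ ball (0 : Sp n) 1)
    (v w : Sp n) :
    inner ℝ v ((hessian u x).toEuclideanLin w) = dirDeriv (dirDeriv u v) w x :=
  SigmaTwo.inner_hessian h.contDiffOn_ball (by norm_num) isOpen_ball hx v w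

variable (b : OrthonormalBasis (Fin n) ℝ (Sp n))

/-- The derivative of the one-jet of `u` in direction `b m`. -/
noncomputable def oneJetDeriv (u : Sp n → ℝ) (b : OrthonormalBasis (Fin n) ℝ (Sp n)) (m : Fin n)
    (x : Sp n) : Jet n :=
  (b m, partial₁ u b m x, ∑ k, partial₂ u b k m x • b k)

theorem hasDerivAt_oneJet (hu : ContDiffOn ℝ 4 u (ball 0 1)) (hx : x ∈ ball (0 : Sp n) 1)
    (m : Fin n) : HasDerivAt (fun t : ℝ => oneJet u (x + t • b m)) (oneJetDeriv u b m x) 0 := by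
  have h1 : HasDerivAt (fun t : ℝ => x + t • b m) (b m) 0 := by
    simpa using ((hasDerivAt_id (0 : ℝ)).smul_const (b m)).const_add x
  have h2 := hasDerivAt_line_partial₀ b hu isOpen_ball hx m
  have h3 : HasDerivAt (fun t : ℝ => gradient u (x + t • b m))
      (∑ k, partial₂ u b k m x • b k) 0 := by
    simp only [gradient_eq_sum u b]
    exact HasDerivAt.fun_sum fun k _ =>
      (hasDerivAt_line_partial₁ b hu isOpen_ball hx k m).smul_const (b k)
  exact h1.prodMk (h2.prodMk h3)

theorem hasDerivAt_oneJetDeriv (hu : ContDiffOn ℝ 4 u (ball 0 1)) (hx : x ∈ ball (0 : Sp n) 1)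
    (m : Fin n) : HasDerivAt (fun t : ℝ => oneJetDeriv u b m (x + t • b m))
      (0, partial₂ u b m m x, ∑ k, partial₃ u b k m m x • b k) 0 := by
  have h3 : HasDerivAt (fun t : ℝ => ∑ k, partial₂ u b k m (x + t • b m) • b k)
      (∑ k, partial₃ u b k m m x • b k) 0 :=
    HasDerivAt.fun_sum fun k _ =>
      (hasDerivAt_line_partial₂ b hu isOpen_ball hx k m m).smul_const (b k)
  exact (hasDerivAt_const 0 (b m)).prodMk
    ((hasDerivAt_line_partial₁ b hu isOpen_ball hx m m).prodMk h3)

theorem IsSolution.sum_eigenvalues_eq (h : IsSolution Ω f u) (hx : x ∈ ball (0 : Sp n) 1) :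
    ∑ i, (h.isHermitian_hessian hx).eigenvalues i = ∑ i, partial₂ u b i i x := by
  rw [sum_eigenvalues _ b]
  exact Finset.sum_congr rfl fun i _ => h.inner_hessian hx _ _

theorem IsSolution.sum_sq_eigenvalues_eq (h : IsSolution Ω f u) (hx : x ∈ ball (0 : Sp n) 1) :
    ∑ i, (h.isHermitian_hessian hx).eigenvalues i ^ 2 = ∑ i, ∑ j, partial₂ u b i j x ^ 2 := by
  rw [sum_sq_eigenvalues _ b]
  exact Finset.sum_congr rfl fun i _ => Finset.sum_congr rfl fun j _ => by
    rw [h.inner_hessian hx]; rfl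

/-- Written with (tr D²u)² − |D²u|², the equation is polynomial in the second derivatives in any
fixed orthonormal frame, so it can be differentiated without differentiating eigenvalues. -/
theorem IsSolution.eqn_partials (h : IsSolution Ω f u) (hx : x ∈ ball (0 : Sp n) 1) :
    (∑ i, partial₂ u b i i x) ^ 2 - ∑ i, ∑ j, partial₂ u b i j x ^ 2 = 2 * f (oneJet u x) := by
  rw [← h.eqn x hx, two_mul_sigma_two (h.isHermitian_hessian hx), h.sum_eigenvalues_eq b hx,
    h.sum_sq_eigenvalues_eq b hx]

theorem IsSolution.hasDerivAt_comp_oneJet (h : IsSolution Ω f u) (hx : x ∈ ball (0 : Sp n) 1)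
    (m : Fin n) : HasDerivAt (fun t : ℝ => f (oneJet u (x + t • b m)))
      (fderiv ℝ f (oneJet u x) (oneJetDeriv u b m x)) 0 := by
  have h1 : HasFDerivAt f (fderiv ℝ f (oneJet u x)) (oneJet u (x + (0 : ℝ) • b m)) := by
    rw [zero_smul, add_zero]
    exact ((h.contDiffOn_f.contDiffAt (h.isOpen.mem_nhds (h.oneJet_mem x hx))).differentiableAt
      (by norm_num)).hasFDerivAt
  exact h1.comp_hasDerivAt 0 (hasDerivAt_oneJet b h.contDiffOn_ball hx m)

theorem IsSolution.hasDerivAt_fderiv_oneJet (h : IsSolution Ω f u) (hx : x ∈ ball (0 : Sp n) 1)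
    (m : Fin n) : HasDerivAt
      (fun t : ℝ => fderiv ℝ f (oneJet u (x + t • b m)) (oneJetDeriv u b m (x + t • b m)))
      (fderiv ℝ (fderiv ℝ f) (oneJet u x) (oneJetDeriv u b m x) (oneJetDeriv u b m x)
        + fderiv ℝ f (oneJet u x)
          (0, partial₂ u b m m x, ∑ k, partial₃ u b k m m x • b k)) 0 := by
  have hdf : ContDiffOn ℝ 1 (fderiv ℝ f) Ω := h.contDiffOn_f.fderiv_of_isOpen h.isOpen (by norm_num)
  have h1 : HasFDerivAt (fderiv ℝ f) (fderiv ℝ (fderiv ℝ f) (oneJet u x))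
      (oneJet u (x + (0 : ℝ) • b m)) := by
    rw [zero_smul, add_zero]
    exact ((hdf.contDiffAt (h.isOpen.mem_nhds (h.oneJet_mem x hx))).differentiableAt
      (by norm_num)).hasFDerivAt
  have h2 := h1.comp_hasDerivAt 0 (hasDerivAt_oneJet b h.contDiffOn_ball hx m)
  have h3 := h2.clm_apply (hasDerivAt_oneJetDeriv b h.contDiffOn_ball hx m)
  simpa using h3

theorem IsSolution.eqn_deriv (h : IsSolution Ω f u) (hx : x ∈ ball (0 : Sp n) 1) (m : Fin n) :
    (∑ i, partial₂ u b i i x) * (∑ i, partial₃ u b i i m x)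
      - ∑ i, ∑ j, partial₂ u b i j x * partial₃ u b i j m x
      = fderiv ℝ f (oneJet u x) (oneJetDeriv u b m x) := by
  have hu := h.contDiffOn_ball
  have d2 := fun i j => hasDerivAt_line_partial₂ b hu isOpen_ball hx i j m
  have h1 := ((HasDerivAt.fun_sum fun i (_ : i ∈ Finset.univ) => d2 i i).fun_pow 2).fun_sub
    (HasDerivAt.fun_sum fun i (_ : i ∈ Finset.univ) =>
      HasDerivAt.fun_sum fun j (_ : j ∈ Finset.univ) => (d2 i j).fun_pow 2)
  have h2 := (h.hasDerivAt_comp_oneJet b hx m).const_mul 2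
  have h3 := eq_of_hasDerivAt_line isOpen_ball hx (fun y hy => h.eqn_partials b hy) h1 h2
  simp only [zero_smul, add_zero, Nat.cast_ofNat, Nat.add_one_sub_one, pow_one, mul_assoc,
    ← Finset.mul_sum] at h3
  linarith

theorem IsSolution.eqn_deriv_deriv (h : IsSolution Ω f u) (hx : x ∈ ball (0 : Sp n) 1)
    (m : Fin n) :
    (∑ i, partial₃ u b i i m x) ^ 2 + (∑ i, partial₂ u b i i x) * (∑ i, partial₄ u b i i m m x)
      - (∑ i, ∑ j, partial₃ u b i j m x ^ 2
        + ∑ i, ∑ j, partial₂ u b i j x * partial₄ u b i j m m x)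
      = fderiv ℝ (fderiv ℝ f) (oneJet u x) (oneJetDeriv u b m x) (oneJetDeriv u b m x)
        + fderiv ℝ f (oneJet u x)
          (0, partial₂ u b m m x, ∑ k, partial₃ u b k m m x • b k) := by
  have hu := h.contDiffOn_ball
  have d2 := fun i j => hasDerivAt_line_partial₂ b hu isOpen_ball hx i j m
  have d3 := fun i j => hasDerivAt_line_partial₃ b hu isOpen_ball hx i j m m
  have h1 := ((HasDerivAt.fun_sum fun i (_ : i ∈ Finset.univ) => d2 i i).fun_mul
      (HasDerivAt.fun_sum fun i (_ : i ∈ Finset.univ) => d3 i i)).fun_sub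
    (HasDerivAt.fun_sum fun i (_ : i ∈ Finset.univ) =>
      HasDerivAt.fun_sum fun j (_ : j ∈ Finset.univ) => (d2 i j).fun_mul (d3 i j))
  have h2 := h.hasDerivAt_fderiv_oneJet b hx m
  have h3 := eq_of_hasDerivAt_line isOpen_ball hx (fun y hy => h.eqn_deriv b hy m) h1 h2
  simp only [zero_smul, add_zero] at h3
  rw [← h3]
  simp only [Finset.sum_add_distrib, ← sq]

end Equation

/-! ### The test function and its derivatives -/

/-- The cutoff function. -/
noncomputable def cutoff {n : ℕ} (x : Sp n) : ℝ := 3 / 4 - ‖x‖ ^ 2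

/-- The gradient weight `α |Du|² / 2 - β (x · Du - u)`. -/
noncomputable def gradWeight {n : ℕ} (α β : ℝ) (u : Sp n → ℝ) (x : Sp n) : ℝ :=
  α / 2 * ‖gradient u x‖ ^ 2 - β * (fderiv ℝ u x x - u x)

/-- The logarithm of the test function in the direction `b o`. -/
noncomputable def logTest {n : ℕ} (α β : ℝ) (u : Sp n → ℝ) (b : Fin n → Sp n) (o : Fin n)
    (x : Sp n) : ℝ :=
  2 * Real.log (cutoff x) + gradWeight α β u x + Real.log (Real.log (partial₂ u b o o x))

/-- The first derivative of `logTest` in direction `b i`. -/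
noncomputable def logTestDeriv {n : ℕ} (α β : ℝ) (u : Sp n → ℝ) (b : Fin n → Sp n) (o i : Fin n)
    (x : Sp n) : ℝ :=
  2 * (-(2 * inner ℝ (b i) x) / cutoff x)
    + (α * ∑ k, partial₁ u b k x * partial₂ u b k i x
      - β * ∑ k, inner ℝ (b k) x * partial₂ u b k i x)
    + partial₃ u b o o i x / (partial₂ u b o o x * Real.log (partial₂ u b o o x))

section Derivatives

variable {n : ℕ} {α β : ℝ} {u : Sp n → ℝ} {x : Sp n} (b : OrthonormalBasis (Fin n) ℝ (Sp n))

theorem norm_sq_gradient (u : Sp n → ℝ) (x : Sp n) :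
    ‖gradient u x‖ ^ 2 = ∑ k, partial₁ u b k x ^ 2 := by
  rw [← b.sum_sq_norm_inner_right]
  refine Finset.sum_congr rfl fun k _ => ?_
  rw [Real.norm_eq_abs, sq_abs, real_inner_comm, gradient, InnerProductSpace.toDual_symm_apply]
  rfl

theorem fderiv_apply_self (u : Sp n → ℝ) (x : Sp n) :
    fderiv ℝ u x x = ∑ k, inner ℝ (b k) x * partial₁ u b k x := by
  conv_lhs => rw [← b.sum_repr' x]
  rw [map_sum]
  refine Finset.sum_congr rfl fun k _ => ?_
  rw [map_smul, b.sum_repr' x]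
  rfl

theorem hasDerivAt_line_cutoff (i : Fin n) :
    HasDerivAt (fun t : ℝ => cutoff (x + t • b i)) (-(2 * inner ℝ (b i) x)) 0 := by
  have h1 : HasDerivAt (fun t : ℝ => x + t • b i) (b i) 0 := by
    simpa using ((hasDerivAt_id (0 : ℝ)).smul_const (b i)).const_add x
  have h2 := h1.norm_sq.const_sub (3 / 4)
  simpa [cutoff, real_inner_comm] using h2

theorem hasDerivAt_line_inner (k i : Fin n) :
    HasDerivAt (fun t : ℝ => inner ℝ (b k) (x + t • b i)) (if k = i then 1 else 0) 0 := by
  have h1 := ((hasDerivAt_id (0 : ℝ)).mul_const (inner ℝ (b k) (b i))).const_add (inner ℝ (b k) x)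
  rw [orthonormal_iff_ite.1 b.orthonormal, one_mul] at h1
  refine h1.congr_of_eventuallyEq (Filter.Eventually.of_forall fun t => ?_)
  simp only [inner_add_right, inner_smul_right, orthonormal_iff_ite.1 b.orthonormal, id]

theorem hasDerivAt_line_gradWeight (hu : ContDiffOn ℝ 4 u (ball 0 1))
    (hx : x ∈ ball (0 : Sp n) 1) (i : Fin n) :
    HasDerivAt (fun t : ℝ => gradWeight α β u (x + t • b i))
      (α * ∑ k, partial₁ u b k x * partial₂ u b k i x
        - β * ∑ k, inner ℝ (b k) x * partial₂ u b k i x) 0 := by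
  have d0 := hasDerivAt_line_partial₀ b hu isOpen_ball hx i
  have d1 := fun k => hasDerivAt_line_partial₁ b hu isOpen_ball hx k i
  have h1 := ((HasDerivAt.fun_sum fun k (_ : k ∈ Finset.univ) => (d1 k).fun_pow 2).const_mul
    (α / 2)).fun_sub (((HasDerivAt.fun_sum fun k (_ : k ∈ Finset.univ) =>
      (hasDerivAt_line_inner b (x := x) k i).fun_mul (d1 k)).fun_sub d0).const_mul β)
  simp only [gradWeight, norm_sq_gradient b, fderiv_apply_self b]
  refine h1.congr_deriv ?_
  simp only [zero_smul, add_zero, Nat.cast_ofNat, Nat.add_one_sub_one, pow_one, mul_assoc,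
    ← Finset.mul_sum, ite_mul, one_mul, zero_mul, Finset.sum_add_distrib, Finset.sum_ite_eq',
    Finset.mem_univ, if_true]
  ring

theorem hasDerivAt_line_logTest (hu : ContDiffOn ℝ 4 u (ball 0 1)) (hx : x ∈ ball (0 : Sp n) 1)
    {o : Fin n} (hc : 0 < cutoff x) (ho : 1 < partial₂ u b o o x) (i : Fin n) :
    HasDerivAt (fun t : ℝ => logTest α β u b o (x + t • b i)) (logTestDeriv α β u b o i x) 0 := by
  have d2 := hasDerivAt_line_partial₂ b hu isOpen_ball hx o o i
  have hlog := Real.log_pos ho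
  have h1 := (((hasDerivAt_line_cutoff b (x := x) i).log (by simpa using hc.ne')).const_mul 2).fun_add
    (hasDerivAt_line_gradWeight (α := α) (β := β) b hu hx i)
  have h2 := h1.fun_add ((d2.log (by simpa using (zero_lt_one.trans ho).ne')).log
    (by simpa using hlog.ne'))
  refine h2.congr_deriv ?_
  simp only [zero_smul, add_zero, logTestDeriv, div_div]

/-- The second derivative of `logTest` in direction `b i`. -/
noncomputable def logTestDeriv₂ (α β : ℝ) (u : Sp n → ℝ) (b : Fin n → Sp n) (o i : Fin n)
    (x : Sp n) : ℝ :=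
  2 * (-2 / cutoff x - 4 * inner ℝ (b i) x ^ 2 / cutoff x ^ 2)
    + (α * ∑ k, (partial₂ u b k i x ^ 2 + partial₁ u b k x * partial₃ u b k i i x)
      - β * (partial₂ u b i i x + ∑ k, inner ℝ (b k) x * partial₃ u b k i i x))
    + (partial₄ u b o o i i x / (partial₂ u b o o x * Real.log (partial₂ u b o o x))
      - partial₃ u b o o i x ^ 2 * (Real.log (partial₂ u b o o x) + 1)
        / (partial₂ u b o o x * Real.log (partial₂ u b o o x)) ^ 2)

theorem hasDerivAt_line_logTestDeriv (hu : ContDiffOn ℝ 4 u (ball 0 1))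
    (hx : x ∈ ball (0 : Sp n) 1) {o : Fin n} (hc : 0 < cutoff x) (ho : 1 < partial₂ u b o o x)
    (i : Fin n) :
    HasDerivAt (fun t : ℝ => logTestDeriv α β u b o i (x + t • b i))
      (logTestDeriv₂ α β u b o i x) 0 := by
  have d1 := fun k => hasDerivAt_line_partial₁ b hu isOpen_ball hx k i
  have d2 := fun k => hasDerivAt_line_partial₂ b hu isOpen_ball hx k i i
  have d2o := hasDerivAt_line_partial₂ b hu isOpen_ball hx o o i
  have d3 := hasDerivAt_line_partial₃ b hu isOpen_ball hx o o i i
  have hin := fun k => hasDerivAt_line_inner b (x := x) k i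
  have hlog := Real.log_pos ho
  have ho0 := zero_lt_one.trans ho
  have h1 := (((hin i).const_mul 2).fun_neg.fun_div (hasDerivAt_line_cutoff b (x := x) i)
    (by simpa using hc.ne')).const_mul 2
  have h2 := ((HasDerivAt.fun_sum fun k (_ : k ∈ Finset.univ) => (d1 k).fun_mul (d2 k)).const_mul
    α).fun_sub ((HasDerivAt.fun_sum fun k (_ : k ∈ Finset.univ) =>
      (hin k).fun_mul (d2 k)).const_mul β)
  have h3 := d3.fun_div (d2o.fun_mul (d2o.log (by simpa using ho0.ne')))
    (by simpa only [zero_smul, add_zero] using (mul_pos ho0 hlog).ne')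
  refine ((h1.fun_add h2).fun_add h3).congr_deriv ?_
  simp only [zero_smul, add_zero, if_true, ite_mul, one_mul, zero_mul, Finset.sum_add_distrib,
    Finset.sum_ite_eq', Finset.mem_univ, logTestDeriv₂, ← sq]
  have hc' := hc.ne'
  have ho' := ho0.ne'
  have hl' := hlog.ne'
  congr 1
  · congr 1
    field_simp
    ring
  · field_simp

theorem isOpen_logTest_domain (hu : ContDiffOn ℝ 4 u (ball 0 1)) (o : Fin n) :
    IsOpen {y : Sp n | y ∈ ball (0 : Sp n) 1 ∧ 0 < cutoff y ∧ 1 < partial₂ u b o o y} := by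
  have h1 : IsOpen {y : Sp n | 0 < cutoff y} :=
    isOpen_lt continuous_const (by unfold cutoff; fun_prop)
  have h2 : IsOpen (ball (0 : Sp n) 1 ∩ partial₂ u b o o ⁻¹' Ioi 1) :=
    (contDiffOn_partial₂ b hu isOpen_ball o o).continuousOn.isOpen_inter_preimage isOpen_ball
      isOpen_Ioi
  have := h2.inter h1
  convert this using 1
  ext y
  simp only [mem_ofPred_eq, mem_inter_iff, mem_preimage, mem_Ioi]
  tauto

theorem logTest_derivs_of_isLocalMax (hu : ContDiffOn ℝ 4 u (ball 0 1))
    (hx : x ∈ ball (0 : Sp n) 1) {o : Fin n} (hc : 0 < cutoff x) (ho : 1 < partial₂ u b o o x)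
    (hmax : IsLocalMax (logTest α β u b o) x) (i : Fin n) :
    logTestDeriv α β u b o i x = 0 ∧ logTestDeriv₂ α β u b o i x ≤ 0 := by
  have h1 := isLocalMax_second_derivative
    (p := fun t : ℝ => logTest α β u b o (x + t • b i))
    (p' := fun t : ℝ => logTestDeriv α β u b o i (x + t • b i)) ?_ ?_
    (hasDerivAt_line_logTestDeriv b hu hx hc ho i)
  · simpa using h1
  · have hmax' : IsLocalMax (logTest α β u b o) (x + (0 : ℝ) • b i) := by simpa using hmax
    exact IsLocalMax.comp_continuous (g := fun t : ℝ => x + t • b i) hmax'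
      (continuousAt_line x (b i) 0)
  · filter_upwards [eventually_line_mem (isOpen_logTest_domain b hu o) ⟨hx, hc, ho⟩ (b i)]
      with t ht
    exact hasDerivAt_line_shift (hasDerivAt_line_logTest b hu ht.1 ht.2.1 ht.2.2 i)

end Derivatives

/-! ### The differential inequality at a maximum point -/

/-- Used with a_ij = u_ijo. The off-diagonal entries a_oi = a_io occur twice, and it is this factor
2 that pays for the directions i ≠ o. -/
theorem sum_diag_add_two_mul_sum_le {n : ℕ} (a : Fin n → Fin n → ℝ) (ha : ∀ i j, a i j = a j i)
    (o : Fin n) :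
    ∑ i, a i i ^ 2 + 2 * ∑ i ∈ Finset.univ.erase o, a o i ^ 2 ≤ ∑ i, ∑ j, a i j ^ 2 := by
  rw [← Finset.add_sum_erase Finset.univ (fun i => a i i ^ 2) (Finset.mem_univ o),
    ← Finset.add_sum_erase Finset.univ (fun i => ∑ j, a i j ^ 2) (Finset.mem_univ o),
    ← Finset.add_sum_erase Finset.univ (fun j => a o j ^ 2) (Finset.mem_univ o)]
  have h : ∑ i ∈ Finset.univ.erase o, (a i i ^ 2 + a o i ^ 2)
      ≤ ∑ i ∈ Finset.univ.erase o, ∑ j, a i j ^ 2 := by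
    refine Finset.sum_le_sum fun i hi => ?_
    rw [ha o i, ← Finset.sum_pair (f := fun j => a i j ^ 2) (Finset.ne_of_mem_erase hi)]
    exact Finset.sum_le_sum_of_subset_of_nonneg (Finset.subset_univ _) fun _ _ _ => sq_nonneg _
  rw [Finset.sum_add_distrib] at h
  linarith

section MaxPoint

variable {n : ℕ} {Ω : Set (Jet n)} {f : Jet n → ℝ} {u : Sp n → ℝ} {x : Sp n}
  {b : OrthonormalBasis (Fin n) ℝ (Sp n)} {l : Fin n → ℝ}

theorem IsSolution.linearized_eqn (h : IsSolution Ω f u) (hx : x ∈ ball (0 : Sp n) 1)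
    (hdiag : ∀ i j, partial₂ u b i j x = if i = j then l i else 0) (m : Fin n) :
    ∑ i, ((∑ j, l j) - l i) * partial₃ u b i i m x
      = fderiv ℝ f (oneJet u x) (oneJetDeriv u b m x) := by
  rw [← h.eqn_deriv b hx m]
  simp only [hdiag, if_true, ite_mul, zero_mul, Finset.sum_ite_eq, Finset.mem_univ, sub_mul,
    Finset.sum_sub_distrib, ← Finset.mul_sum]

theorem IsSolution.linearized_eqn_second (h : IsSolution Ω f u) (hx : x ∈ ball (0 : Sp n) 1)
    (hdiag : ∀ i j, partial₂ u b i j x = if i = j then l i else 0) (m : Fin n) :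
    ∑ i, ((∑ j, l j) - l i) * partial₄ u b i i m m x
      = fderiv ℝ (fderiv ℝ f) (oneJet u x) (oneJetDeriv u b m x) (oneJetDeriv u b m x)
        + fderiv ℝ f (oneJet u x) (0, partial₂ u b m m x, ∑ k, partial₃ u b k m m x • b k)
        + ∑ i, ∑ j, partial₃ u b i j m x ^ 2 - (∑ i, partial₃ u b i i m x) ^ 2 := by
  rw [← h.eqn_deriv_deriv b hx m]
  simp only [hdiag, if_true, ite_mul, zero_mul, Finset.sum_ite_eq, Finset.mem_univ, sub_mul,
    Finset.sum_sub_distrib, ← Finset.mul_sum]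
  ring

theorem oneJetDeriv_of_diag (hdiag : ∀ i j, partial₂ u b i j x = if i = j then l i else 0)
    (m : Fin n) : oneJetDeriv u b m x = (b m, partial₁ u b m x, l m • b m) := by
  simp [oneJetDeriv, hdiag, ite_smul]

/-- At a maximum point of the test function, the linearized operator applied to its logarithm
is nonpositive. -/
theorem IsSolution.linearized_logTest_nonpos {α β : ℝ} (h : IsSolution Ω f u)
    (hx : x ∈ ball (0 : Sp n) 1)
    (hdiag : ∀ i j, partial₂ u b i j x = if i = j then l i else 0) {o : Fin n}
    (hl : ∀ i, l i ≤ ∑ j, l j) (hlo : 1 < l o) (hc : 0 < cutoff x)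
    (hmax : IsLocalMax (logTest α β u b o) x) {w : Fin n → ℝ}
    (hw : ∀ i, w i = -4 * inner ℝ (b i) x / cutoff x
      + (α * partial₁ u b i x - β * inner ℝ (b i) x) * l i) :
    (∀ i, partial₃ u b o o i x = -(l o * Real.log (l o) * w i)) ∧
    -(4 / cutoff x) * ∑ i, ((∑ j, l j) - l i)
      - 8 / cutoff x ^ 2 * ∑ i, ((∑ j, l j) - l i) * inner ℝ (b i) x ^ 2
      + α * (∑ i, ((∑ j, l j) - l i) * l i ^ 2
        + ∑ i, partial₁ u b i x * fderiv ℝ f (oneJet u x) (oneJetDeriv u b i x))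
      - β * (2 * f (oneJet u x)
        + ∑ i, inner ℝ (b i) x * fderiv ℝ f (oneJet u x) (oneJetDeriv u b i x))
      + (fderiv ℝ (fderiv ℝ f) (oneJet u x) (oneJetDeriv u b o x) (oneJetDeriv u b o x)
        + fderiv ℝ f (oneJet u x) (0, partial₂ u b o o x, ∑ k, partial₃ u b k o o x • b k)
        + ∑ i, ∑ j, partial₃ u b i j o x ^ 2 - (∑ i, partial₃ u b i i o x) ^ 2)
        / (l o * Real.log (l o))
      - (Real.log (l o) + 1) * ∑ i, ((∑ j, l j) - l i) * w i ^ 2 ≤ 0 := by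
  have hu := h.contDiffOn_ball
  have hoo : partial₂ u b o o x = l o := by simp [hdiag]
  have hL := Real.log_pos hlo
  have hlo0 : 0 < l o := by linarith
  have hd := logTest_derivs_of_isLocalMax b hu hx hc (by rw [hoo]; exact hlo) hmax
  have hthird : ∀ i, partial₃ u b o o i x = -(l o * Real.log (l o) * w i) := by
    intro i
    have h1 := (hd i).1
    simp only [logTestDeriv, hdiag, mul_ite, mul_zero, Finset.sum_ite_eq', Finset.mem_univ,
      if_true] at h1
    have h2 : partial₃ u b o o i x / (l o * Real.log (l o)) = -w i := by
      rw [hw]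
      linear_combination h1
    rw [div_eq_iff (by positivity)] at h2
    rw [h2]; ring
  refine ⟨hthird, ?_⟩
  -- Ellipticity: the coefficients σ₁ − λ_i are nonnegative.
  have hsum : ∑ i, ((∑ j, l j) - l i) * logTestDeriv₂ α β u b o i x ≤ 0 :=
    Finset.sum_nonpos fun i _ => mul_nonpos_of_nonneg_of_nonpos (sub_nonneg.2 (hl i)) (hd i).2
  refine le_trans (le_of_eq ?_) hsum
  have hcomm : ∀ k i, partial₃ u b k i i x = partial₃ u b i i k x := fun k i => by
    rw [partial₃_comm_left b hu isOpen_ball hx, partial₃_comm_right b hu isOpen_ball hx]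
  have hterm : ∀ i, ((∑ j, l j) - l i) * logTestDeriv₂ α β u b o i x
      = -(4 / cutoff x) * ((∑ j, l j) - l i)
        - 8 / cutoff x ^ 2 * (((∑ j, l j) - l i) * inner ℝ (b i) x ^ 2)
        + α * (((∑ j, l j) - l i) * l i ^ 2
          + ∑ k, partial₁ u b k x * (((∑ j, l j) - l i) * partial₃ u b i i k x))
        - β * (((∑ j, l j) - l i) * l i
          + ∑ k, inner ℝ (b k) x * (((∑ j, l j) - l i) * partial₃ u b i i k x))
        + (((∑ j, l j) - l i) * partial₄ u b i i o o x) / (l o * Real.log (l o))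
        - (Real.log (l o) + 1) * (((∑ j, l j) - l i) * w i ^ 2) := by
    intro i
    have e : ∀ a : Fin n → ℝ, ∑ k, a k * (((∑ j, l j) - l i) * partial₃ u b i i k x)
        = ((∑ j, l j) - l i) * ∑ k, a k * partial₃ u b i i k x := fun a => by
      rw [Finset.mul_sum]
      exact Finset.sum_congr rfl fun k _ => by ring
    rw [e, e, logTestDeriv₂, hthird, partial₄_comm_pairs b hu isOpen_ball hx]
    simp only [hdiag, hcomm _ i, Finset.sum_add_distrib, ite_pow, Finset.sum_ite_eq',
      Finset.mem_univ, if_true, ne_eq, OfNat.ofNat_ne_zero, not_false_eq_true, zero_pow]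
    field_simp
    ring
  -- σ₂ is homogeneous of degree two, hence Euler's relation.
  have hFl : ∑ i, ((∑ j, l j) - l i) * l i = 2 * f (oneJet u x) := by
    rw [← h.eqn_partials b hx]
    simp only [hdiag, if_true, ite_pow, Finset.sum_ite_eq, Finset.mem_univ, sub_mul, ne_eq,
      OfNat.ofNat_ne_zero, not_false_eq_true, zero_pow, Finset.sum_sub_distrib, ← Finset.mul_sum,
      ← sq]
  have hswap : ∀ a : Fin n → ℝ,
      ∑ i, ∑ k, a k * (((∑ j, l j) - l i) * partial₃ u b i i k x)
        = ∑ k, a k * fderiv ℝ f (oneJet u x) (oneJetDeriv u b k x) := fun a => by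
    rw [Finset.sum_comm]
    refine Finset.sum_congr rfl fun k _ => ?_
    rw [← Finset.mul_sum, h.linearized_eqn hx hdiag]
  rw [Finset.sum_congr rfl fun i _ => hterm i, ← h.linearized_eqn_second hx hdiag]
  simp only [Finset.sum_add_distrib, Finset.sum_sub_distrib, ← Finset.mul_sum, ← Finset.sum_div]
  rw [hswap, hswap, hFl]

end MaxPoint

/-- Since t ≥ 1, the jet (e, v, te) has norm at most (2 + B₁)t; the extra 1 in `hK` covers the
u-derivative of f. -/
theorem jet_form_lower_bound {n : ℕ} {K B₁ B₂ v t : ℝ} {D : Jet n →L[ℝ] ℝ}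
    {H : Jet n →L[ℝ] Jet n →L[ℝ] ℝ} {e : Sp n} (hB₁ : 0 ≤ B₁) (hB₂ : 0 ≤ B₂)
    (hK : B₂ * ((2 + B₁) ^ 2 + 1) ≤ K) (hD : ‖D‖ ≤ B₂) (hH : ‖H‖ ≤ B₂) (he : ‖e‖ = 1)
    (hv : |v| ≤ B₁) (ht : 1 ≤ t) :
    -(K * t ^ 2) ≤ H (e, v, t • e) (e, v, t • e) + D (0, t, 0) := by
  have ht0 : 0 < t := by linarith
  have h4 : |D (0, t, 0)| ≤ B₂ * t := by
    refine (D.le_of_opNorm_le hD _).trans ?_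
    refine mul_le_mul_of_nonneg_left ?_ hB₂
    simp only [Prod.norm_mk, norm_zero, Real.norm_eq_abs, abs_of_pos ht0]
    exact max_le ht0.le (max_le le_rfl ht0.le)
  have h5 : ‖((e, v, t • e) : Jet n)‖ ≤ 1 + B₁ + t := by
    simp only [Prod.norm_mk, norm_smul, he, Real.norm_eq_abs, mul_one, abs_of_pos ht0]
    exact max_le (by linarith) (max_le (by linarith) (by linarith))
  have h6 : |H (e, v, t • e) (e, v, t • e)| ≤ B₂ * (1 + B₁ + t) * (1 + B₁ + t) := by
    have h8 := (H.le_of_opNorm_le hH (e, v, t • e)).trans (mul_le_mul_of_nonneg_left h5 hB₂)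
    exact (ContinuousLinearMap.le_of_opNorm_le _ h8 _).trans
      (mul_le_mul_of_nonneg_left h5 (by positivity))
  have h8 : 1 + B₁ + t ≤ (2 + B₁) * t := by
    nlinarith only [ht, mul_nonneg hB₁ (sub_nonneg.2 ht)]
  have h9 : (1 + B₁ + t) ^ 2 ≤ ((2 + B₁) * t) ^ 2 := pow_le_pow_left₀ (by linarith) h8 2
  have h10 := mul_le_mul_of_nonneg_left h9 hB₂
  have h11 := mul_le_mul_of_nonneg_right hK (sq_nonneg t)
  have h12 : B₂ * t ≤ B₂ * t ^ 2 := mul_le_mul_of_nonneg_left (by nlinarith only [ht]) hB₂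
  nlinarith only [h10, h11, h12, (abs_le.1 h4).1, (abs_le.1 h6).1]

/-- Feeds the differential inequality into the algebraic bound, in the eigenframe of D²u at the
maximum point. The frame stays fixed while u varies. -/
theorem exists_log_bound_at_max (n : ℕ) {K A B₁ B₂ : ℝ} (hK : 1 ≤ K) (hA : 0 ≤ A) (hB₁ : 0 ≤ B₁)
    (hB₂ : 0 ≤ B₂) (hK₁ : B₁ ≤ K) (hK₂ : B₂ * ((2 + B₁) ^ 2 + 1) ≤ K) :
    ∃ α β Λ C : ℝ, 0 ≤ α ∧ 0 ≤ β ∧ Real.exp 1 < Λ ∧ 0 ≤ C ∧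
      ∀ (Ω : Set (Jet n)) (f : Jet n → ℝ) (u : Sp n → ℝ) (x : Sp n) (h : IsSolution Ω f u)
        (hx : x ∈ ball (0 : Sp n) 1) (o : Fin n),
        ‖fderiv ℝ u x‖ ≤ B₁ → 1 / K ≤ f (oneJet u x) → f (oneJet u x) ≤ B₂ →
        ‖fderiv ℝ f (oneJet u x)‖ ≤ B₂ → ‖fderiv ℝ (fderiv ℝ f) (oneJet u x)‖ ≤ B₂ →
        0 < sigma 1 (hessian u x) → -A ≤ sigma 3 (hessian u x) →
        (∀ i, (h.isHermitian_hessian hx).eigenvalues i ≤ (h.isHermitian_hessian hx).eigenvalues o) →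
        Λ ≤ (h.isHermitian_hessian hx).eigenvalues o → 0 < cutoff x →
        IsLocalMax (logTest α β u (h.isHermitian_hessian hx).eigenvectorBasis o) x →
        cutoff x ^ 2 * Real.log ((h.isHermitian_hessian hx).eigenvalues o) ≤ C := by
  obtain ⟨α, β, Λ, C, hα, hβ, hΛ, hC, hbound⟩ := exists_max_point_bound n hK hA
  refine ⟨α, β, Λ, C, hα, hβ, hΛ, hC, ?_⟩
  intro Ω f u x h hx o hu1 hf1 hf2 hdf hddf hσ1 hσ3 hl hlΛ hc hmax
  set hW := h.isHermitian_hessian hx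
  set l := hW.eigenvalues
  set b := hW.eigenvectorBasis
  have hu := h.contDiffOn_ball
  have hdiag : ∀ i j, partial₂ u b i j x = if i = j then l i else 0 := fun i j => by
    rw [← inner_eigenvectorBasis hW, h.inner_hessian hx]; rfl
  have hlo1 : 1 < l o := by
    have : 1 < Real.exp 1 := Real.one_lt_exp_iff.2 one_pos
    linarith
  have hσ0 : 0 < ∑ i, l i := by rwa [sigma_one_eq_sum hW] at hσ1
  have h2 : (∑ i, l i) ^ 2 - ∑ i, l i ^ 2 = 2 * f (oneJet u x) := by
    rw [← h.eqn x hx, two_mul_sigma_two hW]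
  have hf0 : 0 < f (oneJet u x) := lt_of_lt_of_le (by positivity) hf1
  have hlσ : ∀ i, l i ≤ ∑ j, l j := fun i => by
    have h3 : l i ^ 2 ≤ (∑ j, l j) ^ 2 :=
      (Finset.single_le_sum (f := fun i => l i ^ 2) (fun i _ => sq_nonneg _)
        (Finset.mem_univ i)).trans (by linarith)
    exact (le_abs_self _).trans (abs_le_of_sq_le_sq h3 hσ0.le)
  have hbn : ∀ i, ‖b i‖ = 1 := b.norm_eq_one
  have hv : ∀ i, |partial₁ u b i x| ≤ B₁ := fun i => by
    have := (fderiv ℝ u x).le_of_opNorm_le hu1 (b i)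
    rwa [hbn, mul_one] at this
  obtain ⟨w, hw⟩ : ∃ w : Fin n → ℝ, ∀ i, w i = -4 * inner ℝ (b i) x / cutoff x
      + (α * partial₁ u b i x - β * inner ℝ (b i) x) * l i := ⟨_, fun _ => rfl⟩
  obtain ⟨hthird, hmain⟩ := h.linearized_logTest_nonpos hx hdiag hlσ hlo1 hc hmax hw
  have hB12 : 0 ≤ B₂ * B₁ := by positivity
  have hB2K : B₂ ≤ K := by nlinarith [mul_nonneg hB₂ hB₁, mul_nonneg hB12 hB₁]
  have hjet : ∀ i, oneJetDeriv u b i x = l i • ((0, 0, b i) : Jet n) + (b i, partial₁ u b i x, 0) :=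
    fun i => by
      rw [oneJetDeriv_of_diag hdiag]
      simp
  refine hbound l w (fun i => inner ℝ (b i) x) (fun i => partial₁ u b i x)
    (fun i => fderiv ℝ f (oneJet u x) (0, 0, b i))
    (fun i => fderiv ℝ f (oneJet u x) (b i, partial₁ u b i x, 0))
    (fun i => fderiv ℝ f (oneJet u x) (oneJetDeriv u b i x))
    (fun i => partial₃ u b i i o x) o (cutoff x) (f (oneJet u x)) _ _ hc ?_ hl hσ0 hf1
    (hf2.trans hB2K) h2 ?_ hlΛ (fun i => (hv i).trans hK₁) ?_ ?_ ?_ hw (hthird o)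
    (h.linearized_eqn hx hdiag o) ?_ ?_ hmain
  · rw [cutoff, ← b.sum_sq_norm_inner_right]
    simp
  · rw [← six_mul_sigma_three hW]
    linarith
  · intro i
    have := (fderiv ℝ f (oneJet u x)).le_of_opNorm_le hdf ((0, 0, b i) : Jet n)
    simp only [Prod.norm_mk, norm_zero, hbn, Real.norm_eq_abs] at this
    norm_num at this
    linarith
  · intro i
    have h3 := (fderiv ℝ f (oneJet u x)).le_of_opNorm_le hdf ((b i, partial₁ u b i x, 0) : Jet n)
    have h4 : ‖((b i, partial₁ u b i x, 0) : Jet n)‖ ≤ 1 + B₁ := by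
      simp only [Prod.norm_mk, norm_zero, hbn, Real.norm_eq_abs]
      refine max_le (by linarith) (max_le (by linarith [hv i]) (by linarith))
    refine h3.trans ((mul_le_mul_of_nonneg_left h4 hB₂).trans ?_)
    nlinarith [mul_nonneg hB12 hB₁]
  · intro i
    rw [hjet, map_add, map_smul, smul_eq_mul]
    ring
  -- Third derivatives enter the second derivative of f only through u_koo = u_ook, which the
  -- critical point relation determines.
  · have h3 : fderiv ℝ f (oneJet u x) (0, partial₂ u b o o x, ∑ k, partial₃ u b k o o x • b k)
        = fderiv ℝ f (oneJet u x) (0, l o, 0)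
          + ∑ i, fderiv ℝ f (oneJet u x) (0, 0, b i) * -(l o * Real.log (l o) * w i) := by
      have e : ((0, partial₂ u b o o x, ∑ k, partial₃ u b k o o x • b k) : Jet n)
          = (0, l o, 0) + ∑ k, -(l o * Real.log (l o) * w k) • ((0, 0, b k) : Jet n) := by
        have e1 : ∀ k, partial₃ u b k o o x = -(l o * Real.log (l o) * w k) := fun k => by
          rw [partial₃_comm_left b hu isOpen_ball hx, partial₃_comm_right b hu isOpen_ball hx,
            hthird]
        simp only [e1, hdiag, if_true]
        refine Prod.ext ?_ (Prod.ext ?_ ?_)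
        · simp [Prod.fst_sum]
        · simp [Prod.fst_sum, Prod.snd_sum]
        · simp [Prod.snd_sum]
      rw [e, map_add, map_sum]
      congr 1
      exact Finset.sum_congr rfl fun k _ => by rw [map_smul, smul_eq_mul, mul_comm]
    have h4 := jet_form_lower_bound hB₁ hB₂ hK₂ hdf hddf (hbn o) (hv o) hlo1.le
    rw [h3, oneJetDeriv_of_diag hdiag]
    linarith only [h4]
  · have h3 := sum_diag_add_two_mul_sum_le (fun i j => partial₃ u b i j o x)
      (fun i j => partial₃_comm_left b hu isOpen_ball hx i j o) o
    refine le_trans (le_of_eq ?_) h3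
    congr 2
    refine Finset.sum_congr rfl fun i _ => ?_
    rw [partial₃_comm_right b hu isOpen_ball hx, hthird, neg_sq]

/-! ### Pointwise bounds from the norms -/

theorem norm_iteratedFDeriv_le_of_cNorm_le {F : Type*} [NormedAddCommGroup F] [NormedSpace ℝ F]
    {k j : ℕ} {S : Set F} {g : F → ℝ} {K : ℝ≥0} (h : cNorm k S g ≤ K) (hj : j ≤ k) {y : F}
    (hy : y ∈ S) : ‖iteratedFDeriv ℝ j g y‖ ≤ K := by
  have h1 : ‖iteratedFDeriv ℝ j g y‖ₑ ≤ cNorm k S g :=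
    (le_iSup₂ (f := fun y (_ : y ∈ S) => ‖iteratedFDeriv ℝ j g y‖ₑ) y hy).trans
      (Finset.single_le_sum (f := fun j => ⨆ y ∈ S, ‖iteratedFDeriv ℝ j g y‖ₑ)
        (fun _ _ => zero_le) (Finset.mem_range.2 (Nat.lt_succ_of_le hj)))
  have h2 := h1.trans h
  rw [enorm_eq_nnnorm, ENNReal.coe_le_coe] at h2
  exact_mod_cast h2

theorem abs_le_of_supNorm_le {F : Type*} {S : Set F} {g : F → ℝ} {K : ℝ≥0}
    (h : supNorm S g ≤ K) {y : F} (hy : y ∈ S) : |g y| ≤ K := by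
  have h1 : ‖g y‖ₑ ≤ supNorm S g := le_iSup₂ (f := fun y (_ : y ∈ S) => ‖g y‖ₑ) y hy
  have h2 := h1.trans h
  rw [enorm_eq_nnnorm, ENNReal.coe_le_coe] at h2
  exact_mod_cast h2

theorem hessianNorm_sq {n : ℕ} {u : Sp n → ℝ} {x : Sp n} (hW : (hessian u x).IsHermitian) :
    hessianNorm u x ^ 2 = ∑ i, hW.eigenvalues i ^ 2 := by
  have h1 : hessianNorm u x ^ 2 = ∑ i, ∑ j, hessian u x i j ^ 2 :=
    Real.sq_sqrt (Finset.sum_nonneg fun i _ => Finset.sum_nonneg fun j _ => sq_nonneg _)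
  rw [h1, sum_sq_eigenvalues hW (EuclideanSpace.basisFun (Fin n) ℝ)]
  refine Finset.sum_congr rfl fun i _ => Finset.sum_congr rfl fun j _ => ?_
  simp [Matrix.toLpLin_apply, PiLp.inner_apply]

/-! ### Convex solutions -/

section Convex

variable {n : ℕ} {Ω : Set (Jet n)} {f : Jet n → ℝ} {u : Sp n → ℝ} {x : Sp n}

/-- By midpoint convexity, t ↦ −(u(x + tv) + u(x − tv)) has a maximum at 0; its second derivative
there is −2u_vv. -/
theorem IsSolution.dirDeriv_dirDeriv_nonneg_of_convexOn (h : IsSolution Ω f u)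
    (hconv : ConvexOn ℝ (ball (0 : Sp n) 1) u) (hx : x ∈ ball (0 : Sp n) 1) (v : Sp n) :
    0 ≤ dirDeriv (dirDeriv u v) v x := by
  have hu := h.contDiffOn_ball
  have hu1 : ContDiffOn ℝ 3 (dirDeriv u v) (ball 0 1) :=
    contDiffOn_dirDeriv hu isOpen_ball (by norm_num) v
  have e1 := eventually_line_mem isOpen_ball hx v
  have e2 := eventually_line_mem isOpen_ball hx (-v)
  have hneg : ∀ (g : Sp n → ℝ) (y : Sp n), dirDeriv g (-v) y = -dirDeriv g v y := fun g y => by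
    simp [dirDeriv]
  have h1 := isLocalMax_second_derivative
    (p := fun t : ℝ => -(u (x + t • v) + u (x + t • -v)))
    (p' := fun t : ℝ => -(dirDeriv u v (x + t • v) + -dirDeriv u v (x + t • -v)))
    (p'' := -(dirDeriv (dirDeriv u v) v x + -(-dirDeriv (dirDeriv u v) v x))) ?_ ?_ ?_
  · linarith [h1.2]
  · filter_upwards [e1, e2] with t ht1 ht2
    have h2 := hconv.2 ht1 ht2 (by norm_num : (0 : ℝ) ≤ 1 / 2) (by norm_num : (0 : ℝ) ≤ 1 / 2)
      (by norm_num)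
    have e : (1 / 2 : ℝ) • (x + t • v) + (1 / 2 : ℝ) • (x + t • -v) = x := by module
    rw [e, smul_eq_mul, smul_eq_mul] at h2
    simp only [zero_smul, add_zero]
    linarith
  · filter_upwards [e1, e2] with t ht1 ht2
    have d1 := hasDerivAt_line_shift (hasDerivAt_line_of_contDiffOn hu (by norm_num) isOpen_ball ht1 v)
    have d2 := hasDerivAt_line_shift
      (hasDerivAt_line_of_contDiffOn hu (by norm_num) isOpen_ball ht2 (-v))
    rw [hneg] at d2
    exact (d1.fun_add d2).fun_neg
  · have d1 := hasDerivAt_line_of_contDiffOn hu1 (by norm_num) isOpen_ball hx v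
    have d2 := hasDerivAt_line_of_contDiffOn hu1 (by norm_num) isOpen_ball hx (-v)
    rw [hneg] at d2
    exact (d1.fun_add d2.fun_neg).fun_neg

theorem IsSolution.eigenvalues_nonneg_of_convexOn (h : IsSolution Ω f u)
    (hconv : ConvexOn ℝ (ball (0 : Sp n) 1) u) (hx : x ∈ ball (0 : Sp n) 1) (i : Fin n) :
    0 ≤ (h.isHermitian_hessian hx).eigenvalues i := by
  have h1 := inner_eigenvectorBasis (h.isHermitian_hessian hx) i i
  rw [if_pos rfl, h.inner_hessian hx] at h1
  rw [← h1]
  exact h.dirDeriv_dirDeriv_nonneg_of_convexOn hconv hx _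

/-- If σ₁ vanished, 2f = σ₁² − Σλ_i² would not be positive. -/
theorem IsSolution.sigma_one_pos_of_convexOn (h : IsSolution Ω f u)
    (hconv : ConvexOn ℝ (ball (0 : Sp n) 1) u) (hx : x ∈ ball (0 : Sp n) 1) :
    0 < sigma 1 (hessian u x) := by
  have h1 := two_mul_sigma_two (h.isHermitian_hessian hx)
  rw [h.eqn x hx] at h1
  have h2 := h.f_pos _ (h.oneJet_mem x hx)
  rw [sigma_one_eq_sum (h.isHermitian_hessian hx)]
  refine lt_of_le_of_ne (Finset.sum_nonneg fun i _ => h.eigenvalues_nonneg_of_convexOn hconv hx i)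
    fun h3 => ?_
  rw [← h3] at h1
  have := Finset.sum_nonneg fun i (_ : i ∈ Finset.univ) =>
    sq_nonneg ((h.isHermitian_hessian hx).eigenvalues i)
  linarith

theorem IsSolution.sigma_nonneg_of_convexOn (h : IsSolution Ω f u)
    (hconv : ConvexOn ℝ (ball (0 : Sp n) 1) u) (hx : x ∈ ball (0 : Sp n) 1) (k : ℕ) :
    0 ≤ sigma k (hessian u x) := by
  rw [sigma_eq_eval_esymm (h.isHermitian_hessian hx), MvPolynomial.esymm, map_sum]
  refine Finset.sum_nonneg fun t _ => ?_
  rw [map_prod]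
  refine Finset.prod_nonneg fun i _ => ?_
  rw [MvPolynomial.eval_X]
  exact h.eigenvalues_nonneg_of_convexOn hconv hx i

end Convex

/-! ### The maximum of the test function -/

section MaximumPrinciple

variable {n : ℕ} {Ω : Set (Jet n)} {f : Jet n → ℝ} {u : Sp n → ℝ}

theorem mem_ball_of_cutoff_nonneg {x : Sp n} (hx : 0 ≤ cutoff x) : x ∈ ball (0 : Sp n) 1 := by
  rw [mem_ball_zero_iff]
  rw [cutoff] at hx
  nlinarith [norm_nonneg x]

theorem continuous_cutoff : Continuous (cutoff : Sp n → ℝ) := by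
  unfold cutoff; fun_prop

theorem cutoff_le_one (x : Sp n) : cutoff x ≤ 1 := by
  rw [cutoff]; nlinarith [sq_nonneg ‖x‖]

theorem isCompact_cutoff_nonneg : IsCompact {x : Sp n | 0 ≤ cutoff x} :=
  (isCompact_closedBall (0 : Sp n) 1).of_isClosed_subset
    (isClosed_le continuous_const continuous_cutoff)
    fun _ hx => ball_subset_closedBall (mem_ball_of_cutoff_nonneg hx)

/-- The test function of the maximum principle. -/
noncomputable def testFun (α β : ℝ) (u : Sp n → ℝ) (z : Sp n × Sp n) : ℝ :=
  cutoff z.1 ^ 2 * Real.exp (gradWeight α β u z.1)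
    * Real.log (max (fderiv ℝ (fderiv ℝ u) z.1 z.2 z.2) (Real.exp 1))

theorem norm_gradient (u : Sp n → ℝ) (x : Sp n) : ‖gradient u x‖ = ‖fderiv ℝ u x‖ := by
  rw [gradient, LinearIsometryEquiv.norm_map]

theorem continuousOn_testFun (α β : ℝ) (hu : ContDiffOn ℝ 4 u (ball 0 1)) :
    ContinuousOn (testFun α β u) ({x : Sp n | 0 ≤ cutoff x} ×ˢ sphere 0 1) := by
  have hm : MapsTo Prod.fst ({x : Sp n | 0 ≤ cutoff x} ×ˢ sphere (0 : Sp n) 1)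
      (ball (0 : Sp n) 1) := fun z hz => mem_ball_of_cutoff_nonneg hz.1
  have hd1 : ContDiffOn ℝ 3 (fderiv ℝ u) (ball 0 1) :=
    hu.fderiv_of_isOpen isOpen_ball (by norm_num)
  have hd2 : ContDiffOn ℝ 2 (fderiv ℝ (fderiv ℝ u)) (ball 0 1) :=
    hd1.fderiv_of_isOpen isOpen_ball (by norm_num)
  have c0 := hu.continuousOn.comp continuousOn_fst hm
  have c1 := hd1.continuousOn.comp continuousOn_fst hm
  have c2 := hd2.continuousOn.comp continuousOn_fst hm
  have cc : ContinuousOn (fun z : Sp n × Sp n => cutoff z.1)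
      ({x : Sp n | 0 ≤ cutoff x} ×ˢ sphere (0 : Sp n) 1) :=
    (continuous_cutoff.comp continuous_fst).continuousOn
  have cw : ContinuousOn (fun z : Sp n × Sp n => gradWeight α β u z.1)
      ({x : Sp n | 0 ≤ cutoff x} ×ˢ sphere (0 : Sp n) 1) := by
    simp only [gradWeight, norm_gradient]
    exact (continuousOn_const.mul (c1.norm.pow 2)).sub
      (continuousOn_const.mul ((c1.clm_apply continuousOn_fst).sub c0))
  refine ((cc.pow 2).mul cw.rexp).mul (ContinuousOn.log ?_ ?_)
  · exact ContinuousOn.sup ((c2.clm_apply continuousOn_snd).clm_apply continuousOn_snd)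
      continuousOn_const
  · exact fun z _ => (lt_of_lt_of_le (Real.exp_pos 1) (le_max_right _ _)).ne'

theorem one_le_log_max_exp_one (a : ℝ) : 1 ≤ Real.log (max a (Real.exp 1)) := by
  rw [Real.le_log_iff_exp_le (lt_of_lt_of_le (Real.exp_pos 1) (le_max_right _ _))]
  exact le_max_right _ _

theorem abs_gradWeight_le {α β B : ℝ} {x : Sp n} (hα : 0 ≤ α) (hβ : 0 ≤ β)
    (hx : x ∈ ball (0 : Sp n) 1) (h0 : |u x| ≤ B) (h1 : ‖fderiv ℝ u x‖ ≤ B) :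
    |gradWeight α β u x| ≤ α / 2 * B ^ 2 + β * (2 * B) := by
  have hx1 : ‖x‖ ≤ 1 := (mem_ball_zero_iff.1 hx).le
  have hB : 0 ≤ B := (norm_nonneg _).trans h1
  have h2 : |fderiv ℝ u x x| ≤ B := by
    refine ((fderiv ℝ u x).le_of_opNorm_le h1 x).trans ?_
    exact mul_le_of_le_one_right hB hx1
  rw [gradWeight, norm_gradient]
  refine (abs_sub _ _).trans (add_le_add ?_ ?_)
  · rw [abs_of_nonneg (by positivity)]
    gcongr
  · rw [abs_mul, abs_of_nonneg hβ]
    refine mul_le_mul_of_nonneg_left ((abs_sub _ _).trans ?_) hβ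
    linarith

theorem IsSolution.fderiv_fderiv_apply (h : IsSolution Ω f u) {x : Sp n}
    (hx : x ∈ ball (0 : Sp n) 1) (v w : Sp n) :
    fderiv ℝ (fderiv ℝ u) x w v = inner ℝ v ((hessian u x).toEuclideanLin w) := by
  rw [h.inner_hessian hx, dirDeriv_dirDeriv_apply h.contDiffOn_ball (by norm_num) isOpen_ball hx]

/-- The quadratic form of D²u on unit vectors is largest at a top eigenvector, so the maximal
direction may be taken from the eigenframe. -/
theorem IsSolution.testFun_le_of_eigenvalue (h : IsSolution Ω f u) {α β : ℝ} {x ξ : Sp n}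
    (hx : x ∈ ball (0 : Sp n) 1) (hξ : ξ ∈ sphere (0 : Sp n) 1) {o : Fin n}
    (ho : ∀ i, (h.isHermitian_hessian hx).eigenvalues i
      ≤ (h.isHermitian_hessian hx).eigenvalues o) :
    testFun α β u (x, ξ)
      ≤ testFun α β u (x, (h.isHermitian_hessian hx).eigenvectorBasis o) := by
  have h1 := inner_toEuclideanLin_le (h.isHermitian_hessian hx) ho ξ
  rw [mem_sphere_zero_iff_norm.1 hξ, one_pow, mul_one] at h1
  simp only [testFun, h.fderiv_fderiv_apply hx]
  rw [inner_eigenvectorBasis, if_pos rfl]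
  refine mul_le_mul_of_nonneg_left (Real.log_le_log ?_ (max_le_max_right _ h1)) (by positivity)
  exact lt_of_lt_of_le (Real.exp_pos 1) (le_max_right _ _)

theorem exp_logTest (h : IsSolution Ω f u) {α β : ℝ} {x : Sp n} {b : Fin n → Sp n} {o : Fin n}
    (hx : x ∈ ball (0 : Sp n) 1) (hc : 0 < cutoff x)
    (ho : Real.exp 1 < partial₂ u b o o x) :
    Real.exp (logTest α β u b o x) = testFun α β u (x, b o) := by
  have hp : fderiv ℝ (fderiv ℝ u) x (b o) (b o) = partial₂ u b o o x := by
    rw [h.fderiv_fderiv_apply hx, h.inner_hessian hx]; rfl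
  have hlog : 0 < Real.log (partial₂ u b o o x) :=
    Real.log_pos ((Real.one_lt_exp_iff.2 one_pos).trans ho)
  rw [logTest, testFun, hp, max_eq_left ho.le, Real.exp_add, Real.exp_add, Real.exp_log hlog,
    two_mul, Real.exp_add, Real.exp_log hc, sq]

/-- With the direction frozen and u_oo > e, the truncation by e is inactive near x, and there
`testFun` is the exponential of `logTest`. -/
theorem isLocalMax_logTest (h : IsSolution Ω f u) {α β : ℝ} {x : Sp n}
    {b : OrthonormalBasis (Fin n) ℝ (Sp n)} {o : Fin n}
    (hmax : IsMaxOn (testFun α β u) ({x : Sp n | 0 ≤ cutoff x} ×ˢ sphere 0 1) (x, b o))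
    (hc : 0 < cutoff x) (ho : Real.exp 1 < partial₂ u b o o x) :
    IsLocalMax (logTest α β u b o) x := by
  have hx := mem_ball_of_cutoff_nonneg hc.le
  have hcont : ContinuousAt (partial₂ u b o o) x :=
    (contDiffOn_partial₂ b h.contDiffOn_ball isOpen_ball o o).continuousOn.continuousAt
      (isOpen_ball.mem_nhds hx)
  filter_upwards [continuous_cutoff.continuousAt.eventually (lt_mem_nhds hc),
    hcont.eventually (lt_mem_nhds ho)] with y hy1 hy2
  have h1 : testFun α β u (y, b o) ≤ testFun α β u (x, b o) :=
    hmax ⟨hy1.le, by simp⟩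
  rw [← exp_logTest h hx hc ho, ← exp_logTest h (mem_ball_of_cutoff_nonneg hy1.le) hy1 hy2] at h1
  exact Real.exp_le_exp.1 h1

end MaximumPrinciple

/-! ### From the maximum point to the half ball -/

theorem exists_eigenvalue_bound (n : ℕ) (K₁ K₂ K₃ : ℝ≥0) {A : ℝ} (hA : 0 ≤ A) :
    ∃ E : ℝ, 0 ≤ E ∧ ∀ (Ω : Set (Jet n)) (f : Jet n → ℝ) (u : Sp n → ℝ) (h : IsSolution Ω f u),
      (∀ x ∈ ball (0 : Sp n) 1, 0 < sigma 1 (hessian u x)) →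
      (∀ x ∈ ball (0 : Sp n) 1, -A ≤ sigma 3 (hessian u x)) →
      cNorm 1 (ball (0 : Sp n) 1) u ≤ K₁ → cNorm 2 Ω f ≤ K₂ →
      supNorm Ω (fun y => 1 / f y) ≤ K₃ →
      ∀ x ∈ closedBall (0 : Sp n) (1 / 2), ∀ (hx : x ∈ ball (0 : Sp n) 1) (i : Fin n),
        (h.isHermitian_hessian hx).eigenvalues i ≤ E := by
  obtain ⟨K, hK⟩ : ∃ K : ℝ, K = 1 + K₁ + K₂ * ((2 + K₁) ^ 2 + 1) + K₃ := ⟨_, rfl⟩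
  have hk1 : (0 : ℝ) ≤ K₁ := K₁.2
  have hk2 : (0 : ℝ) ≤ K₂ := K₂.2
  have hk3 : (0 : ℝ) ≤ K₃ := K₃.2
  have hk4 : 0 ≤ (K₂ : ℝ) * ((2 + K₁) ^ 2 + 1) := by positivity
  have hK1 : 1 ≤ K := by linarith
  obtain ⟨α, β, Λ, C, hα, hβ, hΛ, hC, hbound⟩ := exists_log_bound_at_max n (B₁ := K₁) (B₂ := K₂)
    hK1 hA hk1 hk2 (by linarith) (by linarith)
  obtain ⟨Φ, hΦ⟩ : ∃ Φ : ℝ, Φ = α / 2 * K₁ ^ 2 + β * (2 * K₁) := ⟨_, rfl⟩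
  have hlogΛ : 0 ≤ Real.log Λ :=
    Real.log_nonneg (((Real.one_lt_exp_iff.2 one_pos).trans hΛ).le)
  -- The 4 comes from cutoff ≥ 1/2 on the half ball; the two factors exp Φ bound the weight at the
  -- given point and at the maximum point.
  refine ⟨Real.exp (4 * Real.exp Φ * (Real.exp Φ * (C + Real.log Λ))), (Real.exp_pos _).le, ?_⟩
  intro Ω f u h hσ1 hσ3 hcu hcf hsf x hx2 hx i
  have hu0 : ∀ y ∈ ball (0 : Sp n) 1, |u y| ≤ K₁ := fun y hy => by
    have := norm_iteratedFDeriv_le_of_cNorm_le hcu (Nat.zero_le 1) hy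
    rwa [norm_iteratedFDeriv_zero] at this
  have hu1 : ∀ y ∈ ball (0 : Sp n) 1, ‖fderiv ℝ u y‖ ≤ K₁ := fun y hy => by
    have := norm_iteratedFDeriv_le_of_cNorm_le hcu le_rfl hy
    rwa [norm_iteratedFDeriv_one] at this
  have hW : ∀ y ∈ ball (0 : Sp n) 1, |gradWeight α β u y| ≤ Φ := fun y hy =>
    hΦ ▸ abs_gradWeight_le hα hβ hy (hu0 y hy) (hu1 y hy)
  obtain ⟨⟨x₀, ξ₀⟩, ⟨hx₀c, hξ₀⟩, hmax⟩ := (isCompact_cutoff_nonneg.prod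
    (isCompact_sphere (0 : Sp n) 1)).exists_isMaxOn
    ⟨(0, (h.isHermitian_hessian hx).eigenvectorBasis i), by simp [cutoff]; norm_num⟩
    (continuousOn_testFun α β h.contDiffOn_ball)
  have hx₀ : x₀ ∈ ball (0 : Sp n) 1 := mem_ball_of_cutoff_nonneg hx₀c
  obtain ⟨o, -, ho⟩ := Finset.exists_max_image Finset.univ
    (h.isHermitian_hessian hx₀).eigenvalues ⟨i, Finset.mem_univ i⟩
  have ho' := fun i => ho i (Finset.mem_univ i)
  set b := (h.isHermitian_hessian hx₀).eigenvectorBasis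
  set l := (h.isHermitian_hessian hx₀).eigenvalues
  have hmax' : IsMaxOn (testFun α β u) ({x : Sp n | 0 ≤ cutoff x} ×ˢ sphere 0 1) (x₀, b o) :=
    fun z hz => (hmax hz).trans (h.testFun_le_of_eigenvalue hx₀ hξ₀ ho')
  have hoo : partial₂ u b o o x₀ = l o := by
    have h1 := inner_eigenvectorBasis (h.isHermitian_hessian hx₀) o o
    rw [if_pos rfl, h.inner_hessian hx₀] at h1
    exact h1
  have hexpΦ : ∀ y ∈ ball (0 : Sp n) 1, Real.exp (gradWeight α β u y) ≤ Real.exp Φ :=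
    fun y hy => Real.exp_le_exp.2 ((le_abs_self _).trans (hW y hy))
  have hkey : cutoff x₀ ^ 2 * Real.log (max (l o) (Real.exp 1)) ≤ C + Real.log Λ := by
    have hc1 : cutoff x₀ ^ 2 ≤ 1 := pow_le_one₀ hx₀c (cutoff_le_one x₀)
    -- The maximum principle is needed only for a large eigenvalue at an interior point of the
    -- cutoff region.
    rcases lt_or_ge (l o) Λ with hl | hl
    · have h1 : Real.log (max (l o) (Real.exp 1)) ≤ Real.log Λ :=
        Real.log_le_log (lt_of_lt_of_le (Real.exp_pos 1) (le_max_right _ _)) (max_le hl.le hΛ.le)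
      have h2 : 0 ≤ Real.log (max (l o) (Real.exp 1)) :=
        zero_le_one.trans (one_le_log_max_exp_one _)
      have h3 := mul_le_of_le_one_left h2 hc1
      linarith
    rcases (show 0 ≤ cutoff x₀ from hx₀c).eq_or_lt with hc0 | hc0
    · rw [← hc0]
      simp only [ne_eq, OfNat.ofNat_ne_zero, not_false_eq_true, zero_pow, zero_mul]
      linarith
    · rw [max_eq_left (hΛ.le.trans hl)]
      have hJ := h.oneJet_mem x₀ hx₀
      have hf0 := h.f_pos _ hJ
      have hf1 : 1 / K ≤ f (oneJet u x₀) := by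
        have h1 := abs_le_of_supNorm_le hsf hJ
        rw [abs_of_pos (by positivity), div_le_iff₀ hf0] at h1
        rw [div_le_iff₀ (by linarith)]
        nlinarith only [h1, hf0, hK, hk1, hk4]
      have hf2 := norm_iteratedFDeriv_le_of_cNorm_le hcf (Nat.zero_le 2) hJ
      have hf3 := norm_iteratedFDeriv_le_of_cNorm_le hcf one_le_two hJ
      have hf4 := norm_iteratedFDeriv_le_of_cNorm_le hcf le_rfl hJ
      rw [norm_iteratedFDeriv_zero] at hf2
      rw [norm_iteratedFDeriv_one] at hf3
      rw [← one_add_one_eq_two, ← norm_iteratedFDeriv_fderiv, norm_iteratedFDeriv_one] at hf4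
      have h1 := hbound Ω f u x₀ h hx₀ o (hu1 x₀ hx₀) hf1 ((le_abs_self _).trans hf2) hf3 hf4
        (hσ1 x₀ hx₀) (hσ3 x₀ hx₀) ho' hl hc0
        (isLocalMax_logTest h hmax' hc0 (by rw [hoo]; exact hΛ.trans_le hl))
      linarith
  have hM : testFun α β u (x₀, b o) ≤ Real.exp Φ * (C + Real.log Λ) := by
    have hp : fderiv ℝ (fderiv ℝ u) x₀ (b o) (b o) = l o := by
      rw [← hoo, h.fderiv_fderiv_apply hx₀, h.inner_hessian hx₀]; rfl
    simp only [testFun, hp]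
    have h1 := mul_le_mul (hexpΦ x₀ hx₀) hkey (mul_nonneg (sq_nonneg _)
      (zero_le_one.trans (one_le_log_max_exp_one _))) (Real.exp_pos Φ).le
    linarith
  have hcx : 1 / 2 ≤ cutoff x := by
    have h1 : ‖x‖ ≤ 1 / 2 := mem_closedBall_zero_iff.1 hx2
    rw [cutoff]
    nlinarith [norm_nonneg x]
  have hle := (hmax' (show (x, (h.isHermitian_hessian hx).eigenvectorBasis i) ∈ _ from
    ⟨show 0 ≤ cutoff x by linarith, by simp⟩)).trans hM
  have hp : fderiv ℝ (fderiv ℝ u) x ((h.isHermitian_hessian hx).eigenvectorBasis i)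
      ((h.isHermitian_hessian hx).eigenvectorBasis i)
      = (h.isHermitian_hessian hx).eigenvalues i := by
    rw [h.fderiv_fderiv_apply hx, inner_eigenvectorBasis, if_pos rfl]
  simp only [testFun, hp] at hle
  have hΦx : 1 ≤ Real.exp Φ * Real.exp (gradWeight α β u x) := by
    rw [← Real.exp_add]
    exact Real.one_le_exp (by linarith [(abs_le.1 (hW x hx)).1])
  have hlog0 := one_le_log_max_exp_one ((h.isHermitian_hessian hx).eigenvalues i)
  set e := (h.isHermitian_hessian hx).eigenvalues i
  have hlog : Real.log (max e (Real.exp 1)) ≤ 4 * Real.exp Φ * (Real.exp Φ * (C + Real.log Λ)) := by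
    have h1 : 1 ≤ 4 * cutoff x ^ 2 := by nlinarith only [hcx]
    have h2 : 1 ≤ 4 * cutoff x ^ 2 * (Real.exp Φ * Real.exp (gradWeight α β u x)) :=
      one_le_mul_of_one_le_of_one_le h1 hΦx
    have h3 := le_mul_of_one_le_left (zero_le_one.trans hlog0) h2
    have h4 := mul_le_mul_of_nonneg_left hle (show 0 ≤ 4 * Real.exp Φ by positivity)
    linarith only [h3, h4]
  rw [Real.log_le_iff_le_exp (lt_of_lt_of_le (Real.exp_pos 1) (le_max_right _ _))] at hlog
  exact (le_max_left _ _).trans hlog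

/-- An upper bound on the eigenvalues bounds σ₁ > 0 above, and |D²u|² = σ₁² − 2f then also controls
negative eigenvalues. -/
theorem exists_hessianNorm_bound (n : ℕ) (K₁ K₂ K₃ : ℝ≥0) {A : ℝ} (hA : 0 ≤ A) :
    ∃ C : ℝ, ∀ (Ω : Set (Jet n)) (f : Jet n → ℝ) (u : Sp n → ℝ), IsSolution Ω f u →
      (∀ x ∈ ball (0 : Sp n) 1, 0 < sigma 1 (hessian u x)) →
      (∀ x ∈ ball (0 : Sp n) 1, -A ≤ sigma 3 (hessian u x)) →
      cNorm 1 (ball (0 : Sp n) 1) u ≤ K₁ → cNorm 2 Ω f ≤ K₂ →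
      supNorm Ω (fun y => 1 / f y) ≤ K₃ →
      ∀ x ∈ closedBall (0 : Sp n) (1 / 2), hessianNorm u x ≤ C := by
  obtain ⟨E, hE, hbound⟩ := exists_eigenvalue_bound n K₁ K₂ K₃ hA
  refine ⟨n * E, ?_⟩
  intro Ω f u h hσ1 hσ3 hcu hcf hsf x hx2
  have hx : x ∈ ball (0 : Sp n) 1 := closedBall_subset_ball (by norm_num) hx2
  have h1 : ∑ i, (h.isHermitian_hessian hx).eigenvalues i ≤ n * E := by
    refine (Finset.sum_le_sum fun i _ => hbound Ω f u h hσ1 hσ3 hcu hcf hsf x hx2 hx i).trans ?_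
    simp
  have h2 := hσ1 x hx
  have h3 := two_mul_sigma_two (h.isHermitian_hessian hx)
  rw [sigma_one_eq_sum (h.isHermitian_hessian hx)] at h2
  rw [h.eqn x hx, ← hessianNorm_sq] at h3
  have h4 := h.f_pos _ (h.oneJet_mem x hx)
  refine (le_abs_self _).trans ((abs_le_of_sq_le_sq ?_ h2.le).trans h1)
  linarith

end SigmaTwo

theorem theorem3p1 (n : ℕ) (K₁ K₂ K₃ : ℝ≥0) :
    (∀ A : ℝ, 0 ≤ A → ∃ C : ℝ,
      ∀ (Ω : Set (SigmaTwo.Jet n)) (f : SigmaTwo.Jet n → ℝ) (u : SigmaTwo.Sp n → ℝ),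
        SigmaTwo.IsAdmissibleSolution Ω f u →
        (∀ x ∈ ball (0 : SigmaTwo.Sp n) 1, -A ≤ SigmaTwo.sigma 3 (SigmaTwo.hessian u x)) →
        SigmaTwo.cNorm 1 (ball (0 : SigmaTwo.Sp n) 1) u ≤ K₁ →
        SigmaTwo.cNorm 2 Ω f ≤ K₂ →
        SigmaTwo.supNorm Ω (fun y => 1 / f y) ≤ K₃ →
        ∀ x ∈ closedBall (0 : SigmaTwo.Sp n) (1 / 2), SigmaTwo.hessianNorm u x ≤ C) ∧
    (∃ C : ℝ,
      ∀ (Ω : Set (SigmaTwo.Jet n)) (f : SigmaTwo.Jet n → ℝ) (u : SigmaTwo.Sp n → ℝ),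
        SigmaTwo.IsSolution Ω f u →
        ConvexOn ℝ (ball (0 : SigmaTwo.Sp n) 1) u →
        SigmaTwo.cNorm 1 (ball (0 : SigmaTwo.Sp n) 1) u ≤ K₁ →
        SigmaTwo.cNorm 2 Ω f ≤ K₂ →
        SigmaTwo.supNorm Ω (fun y => 1 / f y) ≤ K₃ →
        ∀ x ∈ closedBall (0 : SigmaTwo.Sp n) (1 / 2), SigmaTwo.hessianNorm u x ≤ C) := by
  refine ⟨fun A hA => ?_, ?_⟩
  · obtain ⟨C, hC⟩ := SigmaTwo.exists_hessianNorm_bound n K₁ K₂ K₃ hA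
    exact ⟨C, fun Ω f u h hσ3 => hC Ω f u h.toIsSolution (fun x hx => (h.admissible x hx).1) hσ3⟩
  · obtain ⟨C, hC⟩ := SigmaTwo.exists_hessianNorm_bound n K₁ K₂ K₃ le_rfl
    exact ⟨C, fun Ω f u h hconv => hC Ω f u h (fun x hx => h.sigma_one_pos_of_convexOn hconv hx)
      (fun x hx => by simpa using h.sigma_nonneg_of_convexOn hconv hx 3)⟩
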